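/- For $\tau$ in the upper half plane $\mathcal H$ put $q=e^{2\pi i\tau}$, $(a;q)_\infty=\prod_{n\ge0}(1-aq^n)$, $\eta(\tau)=q^{1/24}(q;q)_\infty$, and for integers $N\ge1$ and $\rho$ with $N\nmid\rho$ put $$f_{N,\rho}(\tau)=q^{\frac{(N-2\rho)^2}{8N}}\,(q^{\rho};q^N)_\infty\,(q^{N-\rho};q^N)_\infty\,(q^N;q^N)_\infty .$$ For $B=\begin{pmatrix}\alpha&\beta\\\gamma&\delta\end{pmatrix}\in \mathrm{SL}_2(\mathbb Z)$ let $B\tau=\frac{\alpha\tau+\beta}{\gamma\tau+\delta}$, let $\nu(B)$ be the $\eta$-multiplier, defined by $\eta(B\tau)=\nu(B)\sqrt{\gamma\tau+\delta}\,\eta(\tau)$ for all $\tau\in\mathcal H$ (principal square root), and, if $4\mid\gamma$, let $B_4=\begin{pmatrix}\alpha&4\beta\\\gamma/4&\delta\end{pmatrix}$. A weakly holomorphic modular form of weight $k\in\mathbb Z$ on a congruence subgroup $\Gamma$ is a holomorphic function $F$ on $\mathcal H$ with $F(B\tau)=(\gamma\tau+\delta)^kF(\tau)$ for all $B\in\Gamma$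 and such that for every $B\in\mathrm{SL}_2(\mathbb Z)$ the function $(\gamma\tau+\delta)^{-k}F(B\tau)$ has an expansion $\sum_{n\ge n_0}a_n e^{2\pi i n\tau/N}$ with $n_0\in\mathbb Z$ and $N$ a positive integer. Let $c>0$ be an odd integer, let $r_0,r_1,\dots,r_{2c}$ be integers, and let $$f(\tau)=\eta(4c^2\tau)^{r_0}\prod_{k=1}^{2c}f_{4c^2,ck}(\tau)^{r_k},\qquad R=\sum_{i=1}^{2c}r_i,\qquad S=\sum_{\substack{1\le i\le 2c\\ i\equiv1\ (2)}}r_i,\qquad T=\sum_{\substack{1\le i\le 2c\\ i\equiv2\ (4)}}r_i .$$ Suppose that $r_0+R=1$, $R\equiv-2\pmod{12}$, $S\equiv-1\pmod 8$ and $T\equiv0\pmod2$. Then for every $B=\begin{pmatrix}\alpha&\beta\\\gamma&\delta\end{pmatrix}\in\Gamma_0(4c^2)\cap\Gamma_1(4c)$ and every $\tau\in\mathcal H$, $$f(B\tau)=(-1)^{\beta+\frac{\alpha-1}{4}+\frac{\beta(\alpha-1)}{4}}\exp\left(-\tfrac{\pi i\beta}{4}\right)\nu(B_4)^{-3}\sqrt{\gamma\tau+\delta}\;f(\tau).$$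 Furthermore, the functions $$g(\tau)=\frac{\eta(4\tau)\eta(\tau)}{\eta(2\tau)}f(\tau),\qquad h(\tau)=\frac{\eta(4c^2\tau)\eta(c^2\tau)}{\eta(2c^2\tau)}f(\tau)$$ are weakly holomorphic modular forms of weight $1$ on $\Gamma_0(4c^2)\cap\Gamma_1(4c)$. -/

import Mathlib

open UpperHalfPlane hiding I
open Complex CongruenceSubgroup
open scoped MatrixGroups ModularForm Manifold Real

/-- A weakly holomorphic modular form of integral weight `k` on a subgroup `Γ` of `SL(2, ℤ)`:
a holomorphic function on the upper half plane which transforms with the factor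
`(γτ + δ) ^ k` under `Γ`, and for which `(γτ + δ) ^ (-k) f(Bτ)` has, for every
`B ∈ SL(2, ℤ)`, an expansion `∑_{n ≥ n₀} aₙ exp (2πinτ/N)` with `n₀ ∈ ℤ`, `N ≥ 1`
(below `n = n₀ + m` with `m ∈ ℕ`). -/
structure IsWeaklyHolomorphicModularForm (Γ : Subgroup SL(2, ℤ)) (k : ℤ) (f : ℍ → ℂ) : Prop where
  holo : MDifferentiable 𝓘(ℂ) 𝓘(ℂ) f
  transform : ∀ B ∈ Γ, ∀ τ : ℍ, f (B • τ) = ((B 1 0 : ℂ) * τ + (B 1 1 : ℂ)) ^ k * f τ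
  expansion : ∀ B : SL(2, ℤ), ∃ (N : ℕ) (n₀ : ℤ) (a : ℕ → ℂ), 0 < N ∧ ∀ τ : ℍ,
    HasSum (fun m : ℕ ↦ a m * exp (2 * π * I * ((n₀ : ℂ) + m) * τ / N))
      (((B 1 0 : ℂ) * τ + (B 1 1 : ℂ)) ^ (-k) * f (B • τ))

/-- The infinite product `(a; q)_∞ = ∏_{n ≥ 0} (1 - a q ^ n)`. -/
noncomputable def qPochhammerInf (a q : ℂ) : ℂ := ∏' n : ℕ, (1 - a * q ^ n)

/-- The generalized eta function
`f_{N,ρ}(τ) = q ^ ((N - 2ρ)² / (8N)) (q ^ ρ, q ^ (N - ρ), q ^ N; q ^ N)_∞`, `q = exp (2πiτ)`. -/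
noncomputable def generalizedEta (N : ℕ) (ρ : ℤ) (τ : ℂ) : ℂ :=
  exp (2 * π * I * τ * (((N : ℂ) - 2 * ρ) ^ 2 / (8 * N))) *
    (qPochhammerInf (exp (2 * π * I * τ * ρ)) (exp (2 * π * I * τ * N)) *
      qPochhammerInf (exp (2 * π * I * τ * ((N : ℂ) - ρ))) (exp (2 * π * I * τ * N)) *
      qPochhammerInf (exp (2 * π * I * τ * N)) (exp (2 * π * I * τ * N)))

/-- The generalized eta quotient `η(4c²τ) ^ r₀ ∏_{k=1}^{2c} f_{4c²,ck}(τ) ^ r_k`. -/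
noncomputable def generalizedEtaQuotient (c : ℕ) (r₀ : ℤ) (r : ℕ → ℤ) (τ : ℍ) : ℂ :=
  η (4 * (c : ℂ) ^ 2 * τ) ^ r₀ *
    ∏ k ∈ Finset.Icc 1 (2 * c), generalizedEta (4 * c ^ 2) ((c * k : ℕ) : ℤ) τ ^ r k

/-- The multiplier `ν(B)` of the Dedekind eta function, the number with
`η(Bτ) = ν(B) √(γτ + δ) η(τ)` (principal square root); it is read off here at `τ = i`, and
`eta_smul_eq_etaMultiplier` shows that it works for every `τ`. -/
noncomputable def etaMultiplier (B : SL(2, ℤ)) : ℂ :=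
  η ((B • UpperHalfPlane.I : ℍ) : ℂ) /
    (((B 1 0 : ℂ) * (UpperHalfPlane.I : ℍ) + (B 1 1 : ℂ)) ^ (1 / 2 : ℂ) *
      η ((UpperHalfPlane.I : ℍ) : ℂ))

theorem eta_smul_pow (B : SL(2, ℤ)) (τ : ℍ) :
    η ((B • τ : ℍ) : ℂ) ^ 24 = ((B 1 0 : ℂ) * τ + (B 1 1 : ℂ)) ^ 12 * η (τ : ℂ) ^ 24 := by
  have h := congrFun (SlashInvariantForm.slash_action_generators_SL2Z
    ModularForm.discriminant_S_invariant ModularForm.discriminant_T_invariant B) τ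
  have h2 := (ModularForm.slash_action_eq'_iff 12 _ B τ).1 h
  simpa [ModularForm.discriminant] using! h2

theorem eta_smul_eq_etaMultiplier (B : SL(2, ℤ)) (τ : ℍ) :
    η ((B • τ : ℍ) : ℂ) =
      etaMultiplier B * ((B 1 0 : ℂ) * τ + (B 1 1 : ℂ)) ^ (1 / 2 : ℂ) * η (τ : ℂ) := by
  have hd : ∀ z : ℍ, ((B 1 0 : ℂ) * z + (B 1 1 : ℂ)) ≠ 0 := fun z ↦ by
    simpa [denom] using denom_ne_zero (B : GL (Fin 2) ℝ) z
  have hη : ∀ z : ℍ, η (z : ℂ) ≠ 0 := fun z ↦ ModularForm.eta_ne_zero z.2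
  have hs : ∀ z : ℍ, ((B 1 0 : ℂ) * z + (B 1 1 : ℂ)) ^ (1 / 2 : ℂ) ≠ 0 := fun z ↦ by
    simp [cpow_eq_zero_iff, hd z]
  have hηc : Continuous fun z : ℍ ↦ η (z : ℂ) := continuous_iff_continuousAt.2 fun z ↦
    (ModularForm.differentiableAt_eta_of_mem_upperHalfPlaneSet z.2).continuousAt.comp
      (f := fun z : ℍ ↦ (z : ℂ)) UpperHalfPlane.continuous_coe.continuousAt
  have hsc : Continuous fun z : ℍ ↦ ((B 1 0 : ℂ) * z + (B 1 1 : ℂ)) ^ (1 / 2 : ℂ) := by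
    by_cases h0 : B 1 0 = 0
    · simpa [h0] using continuous_const
    · refine Continuous.cpow (by fun_prop) continuous_const fun z ↦ Or.inr ?_
      simp [h0, z.im_ne_zero]
  have hBc : Continuous fun z : ℍ ↦ B • z := continuous_const_smul (B : GL (Fin 2) ℝ)
  let φ : ℍ → ℂ := fun z ↦ η ((B • z : ℍ) : ℂ) /
    (((B 1 0 : ℂ) * z + (B 1 1 : ℂ)) ^ (1 / 2 : ℂ) * η (z : ℂ))
  have hφc : Continuous φ := by
    refine (hηc.comp hBc).div (hsc.mul hηc) fun z ↦ ?_
    exact mul_ne_zero (hs z) (hη z)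
  have hφ24 : ∀ z, φ z ^ 24 = 1 := fun z ↦ by
    have h1 : (((B 1 0 : ℂ) * z + (B 1 1 : ℂ)) ^ (1 / 2 : ℂ)) ^ 24 =
        ((B 1 0 : ℂ) * z + (B 1 1 : ℂ)) ^ 12 := by
      rw [← cpow_nat_mul, ← cpow_natCast]
      norm_num
    simp only [φ]
    rw [div_pow, mul_pow, h1, eta_smul_pow,
      div_self (mul_ne_zero (pow_ne_zero _ (hd z)) (pow_ne_zero _ (hη z)))]
  have hfin : ({w : ℂ | w ^ 24 = 1} : Set ℂ).Finite := by
    refine (Polynomial.nthRootsFinset 24 (1 : ℂ)).finite_toSet.subset fun w hw ↦ ?_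
    simpa [Polynomial.mem_nthRootsFinset] using hw
  have key : φ τ = φ UpperHalfPlane.I :=
    isPreconnected_univ.constant_of_mapsTo (T := {w : ℂ | w ^ 24 = 1}) hfin.isDiscrete hφc.continuousOn
      (fun z _ ↦ hφ24 z) (Set.mem_univ _) (Set.mem_univ _)
  change _ = φ UpperHalfPlane.I * _ * _
  rw [← key, mul_assoc, div_mul_cancel₀ _ (mul_ne_zero (hs τ) (hη τ))]

theorem dvd_of_mem_Gamma0 {m n : ℕ} (h : m ∣ n) {B : SL(2, ℤ)} (hB : B ∈ Gamma0 n) :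
    (m : ℤ) ∣ B 1 0 :=
  (Int.natCast_dvd_natCast.2 h).trans ((ZMod.intCast_zmod_eq_zero_iff_dvd _ _).1 hB)

/-- For `B = (α, β; γ, δ)` and `m ∣ γ`, the matrix `B_m = (α, mβ; γ/m, δ)`. -/
def scaledMatrix (m : ℕ) (B : SL(2, ℤ)) (h : (m : ℤ) ∣ B 1 0) : SL(2, ℤ) :=
  ⟨!![B 0 0, m * B 0 1; B 1 0 / m, B 1 1], by
    have hdet := B.det_coe
    rw [Matrix.det_fin_two] at hdet
    rw [Matrix.det_fin_two_of, mul_right_comm, Int.mul_ediv_cancel' h]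
    linarith⟩

/-! Everything is reduced to Klein forms. Up to normalisation these are the Jacobi theta product in
z divided by (q; q)^2, evaluated at z = aτ + b. They have weight -1 and transform under SL(2, ℤ)
without any multiplier, the matrix acting only on the characteristic (a, b)
(`denom_mul_kleinForm_smul`). An integral shift of (a, b) costs an explicit root of unity
(`kleinForm_add_int`). Since f_{N,ρ}(τ) is the Klein form with characteristic (ρ/N, 0) at Nτ times
η(Nτ)^3 (`generalizedEta_eq_kleinForm`), a matrix B in Γ₀(N) with ρα ≡ ρ (mod N) multiplies it by an
explicit phase, ν(B_N)^3 and √(γτ + δ) (`generalizedEta_smul`).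

In the quotient f, with N = 4c², three things are collected. The power of ν(B_N) is r₀ + 3R = 1 +
2R, which is -3 modulo 24 because R ≡ -2 (mod 12). The phases depend only on ∑ r_k k modulo 2 and ∑
r_k k² modulo 8, that is on S and S + 4T, which gives `prod_exp_zpow_eq`. Finally ν(B_{4c²})^3 =
ν(B_4)^3. To see this, η(Mτ) for odd M is written as η(τ)^M times Klein forms at the points j/M. As
in Gauss's lemma, the matrix permutes these points up to sign, so ν(B_M)^3 is a sign depending on M
and δ times ν(B)^{3M}; taking M = c twice kills the sign, and 3c² ≡ 3 (mod 24).

The additional factors in g and h are themselves generalized eta functions, f_{4,1}(τ) and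
f_{4c²,c²}(τ) = f_{4,1}(c²τ). Their multipliers are inverse to that of f, so the products have
weight 1 and trivial multiplier. For the expansions, diag(N, 1)B is A times an upper triangular
matrix with A in SL(2, ℤ), so every factor of f becomes a half-integral power of γτ + δ times a
power of a local parameter times a holomorphic function without zeros on the disc. The absence of
zeros is what permits negative exponents r_k. -/

/-! ### The infinite product (a; q)_∞: convergence, zeros, holomorphy. -/

theorem summable_norm_mul_pow (a : ℂ) {q : ℂ} (hq : ‖q‖ < 1) :
    Summable fun n : ℕ ↦ ‖-(a * q ^ n)‖ := by
  simpa using (summable_geometric_of_lt_one (norm_nonneg q) hq).mul_left ‖a‖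

theorem multipliable_one_sub_mul_pow (a : ℂ) {q : ℂ} (hq : ‖q‖ < 1) :
    Multipliable fun n : ℕ ↦ 1 - a * q ^ n := by
  simpa [sub_eq_add_neg] using multipliable_one_add_of_summable (summable_norm_mul_pow a hq)

theorem qPochhammerInf_eq_mul (a : ℂ) {q : ℂ} (hq : ‖q‖ < 1) :
    qPochhammerInf a q = (1 - a) * qPochhammerInf (a * q) q := by
  have h := (multipliable_one_sub_mul_pow (a * q) hq)
  have h' : Multipliable fun n : ℕ ↦ 1 - a * q ^ (n + 1) := by
    simpa [pow_succ', mul_assoc] using h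
  rw [qPochhammerInf, tprod_eq_zero_mul' (f := fun n : ℕ ↦ 1 - a * q ^ n) h', qPochhammerInf]
  simp [pow_succ', mul_assoc]

theorem qPochhammerInf_ne_zero {a q : ℂ} (hq : ‖q‖ < 1) (h : ∀ n : ℕ, a * q ^ n ≠ 1) :
    qPochhammerInf a q ≠ 0 := by
  have := tprod_one_add_ne_zero_of_summable (f := fun n : ℕ ↦ -(a * q ^ n))
    (fun n ↦ by simpa [← sub_eq_add_neg, sub_ne_zero] using (h n).symm) (summable_norm_mul_pow a hq)
  simpa [qPochhammerInf, sub_eq_add_neg] using this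

theorem qPochhammerInf_ne_zero_of_norm_lt {a q : ℂ} (hq : ‖q‖ < 1) (ha : ‖a‖ < 1) :
    qPochhammerInf a q ≠ 0 := by
  refine qPochhammerInf_ne_zero hq fun n h ↦ ?_
  have h1 : ‖a * q ^ n‖ < 1 := by
    rw [norm_mul, norm_pow]
    calc ‖a‖ * ‖q‖ ^ n ≤ ‖a‖ * 1 := by gcongr; exact pow_le_one₀ (norm_nonneg _) hq.le
      _ < 1 := by simpa
  simp [h] at h1

/-- On a compact set the factors are dominated by a geometric series built from the maxima of |a|
and |q|. Both arguments may vary: the theta product needs a varying a, the expansions at cusps need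
both. -/
theorem differentiableOn_qPochhammerInf {U : Set ℂ} (hU : IsOpen U) {a q : ℂ → ℂ}
    (ha : DifferentiableOn ℂ a U) (hq : DifferentiableOn ℂ q U) (hq1 : ∀ z ∈ U, ‖q z‖ < 1) :
    DifferentiableOn ℂ (fun z ↦ qPochhammerInf (a z) (q z)) U := by
  have key : HasProdLocallyUniformlyOn (fun (n : ℕ) z ↦ 1 + -(a z * q z ^ n))
      (fun z ↦ ∏' n : ℕ, (1 + -(a z * q z ^ n))) U := by
    refine hasProdLocallyUniformlyOn_of_forall_compact hU fun K hK hcK ↦ ?_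
    rcases K.eq_empty_or_nonempty with hN | hN
    · simpa [hasProdUniformlyOn_iff_tendstoUniformlyOn, hN] using tendstoUniformlyOn_empty
    · obtain ⟨z₀, hz₀, _, HB⟩ := hcK.exists_sSup_image_eq_and_ge hN (hq.continuousOn.norm.mono hK)
      obtain ⟨z₁, hz₁, _, HA⟩ := hcK.exists_sSup_image_eq_and_ge hN (ha.continuousOn.norm.mono hK)
      refine ((summable_geometric_of_lt_one (norm_nonneg _) (hq1 z₀ (hK hz₀))).mul_left
        ‖a z₁‖).hasProdUniformlyOn_nat_one_add hcK (.of_forall fun n x hx ↦ ?_) (fun n ↦ ?_)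
      · rw [norm_neg, norm_mul, norm_pow]
        gcongr
        exacts [HA x hx, HB x hx]
      · exact ((ha.mul (hq.pow n)).neg.continuousOn).mono hK
  have := key.differentiableOn (.of_forall fun s ↦ by
    simpa [Finset.prod_fn] using
      DifferentiableOn.finsetProd (fun n _ ↦ ((ha.mul (hq.pow n)).neg.const_add 1))) hU
  simpa [qPochhammerInf, sub_eq_add_neg] using this

/-! ### The theta product in the elliptic variable z and its Jacobi inversion. -/

theorem norm_exp_two_pi_I_mul_lt_one {τ : ℂ} (hτ : 0 < τ.im) : ‖exp (2 * π * I * τ)‖ < 1 :=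
  norm_exp_two_pi_I_lt_one ⟨τ, hτ⟩

theorem exp_two_pi_I_mul_eq_one_iff (z : ℂ) : exp (2 * π * I * z) = 1 ↔ ∃ n : ℤ, z = n := by
  rw [exp_eq_one_iff]
  refine exists_congr fun n ↦ ⟨fun h ↦ ?_, fun h ↦ by rw [h]; ring⟩
  exact mul_left_cancel₀ two_pi_I_ne_zero (h.trans (mul_comm _ _))

/-- The odd entire function of `z` with simple zeros at `ℤ + ℤτ`
`ζ ^ (-1/2) (ζ; q)_∞ (q / ζ; q)_∞ / (q; q)_∞ ^ 2`, where `ζ = exp (2πiz)`, `q = exp (2πiτ)`. -/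
noncomputable def kleinProduct (z τ : ℂ) : ℂ :=
  exp (-(π * I * z)) * (qPochhammerInf (exp (2 * π * I * z)) (exp (2 * π * I * τ)) *
    qPochhammerInf (exp (2 * π * I * (τ - z))) (exp (2 * π * I * τ))) /
      qPochhammerInf (exp (2 * π * I * τ)) (exp (2 * π * I * τ)) ^ 2

theorem kleinProduct_add_one (z τ : ℂ) : kleinProduct (z + 1) τ = -kleinProduct z τ := by
  have h1 : exp (2 * π * I * (z + 1)) = exp (2 * π * I * z) := by
    rw [mul_add, mul_one, exp_periodic]
  have h2 : exp (2 * π * I * (τ - (z + 1))) = exp (2 * π * I * (τ - z)) := by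
    rw [← sub_sub, mul_sub, mul_one, exp_periodic.sub_eq]
  have h3 : exp (-(π * I * (z + 1))) = -exp (-(π * I * z)) := by
    rw [mul_add, mul_one, neg_add, exp_add, exp_neg (π * I), exp_pi_mul_I]
    norm_num
  rw [kleinProduct, h1, h2, h3, kleinProduct]
  ring

theorem kleinProduct_add_one_right (z τ : ℂ) : kleinProduct z (τ + 1) = kleinProduct z τ := by
  have h1 : exp (2 * π * I * (τ + 1)) = exp (2 * π * I * τ) := by
    rw [mul_add, mul_one, exp_periodic]
  have h2 : exp (2 * π * I * (τ + 1 - z)) = exp (2 * π * I * (τ - z)) := by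
    rw [add_sub_right_comm, mul_add, mul_one, exp_periodic]
  rw [kleinProduct, h1, h2, kleinProduct]

theorem one_sub_exp_neg (w : ℂ) : 1 - exp (-w) = -exp (-w) * (1 - exp w) := by
  rw [exp_neg]
  field_simp [exp_ne_zero]
  ring

/-- Splitting off the factor that vanishes at z = 0 leaves two products interchanged by z ↦ -z.
Oddness, the quasi-period τ and the derivative at 0 are all read off from this form. -/
theorem kleinProduct_eq_mul (z : ℂ) {τ : ℂ} (hτ : 0 < τ.im) : kleinProduct z τ =
    (1 - exp (2 * π * I * z)) * (exp (-(π * I * z)) *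
      (qPochhammerInf (exp (2 * π * I * (τ + z))) (exp (2 * π * I * τ)) *
        qPochhammerInf (exp (2 * π * I * (τ - z))) (exp (2 * π * I * τ))) /
          qPochhammerInf (exp (2 * π * I * τ)) (exp (2 * π * I * τ)) ^ 2) := by
  rw [kleinProduct, qPochhammerInf_eq_mul _ (norm_exp_two_pi_I_mul_lt_one hτ), ← exp_add,
    ← mul_add, add_comm z τ]
  ring

theorem kleinProduct_neg (z : ℂ) {τ : ℂ} (hτ : 0 < τ.im) :
    kleinProduct (-z) τ = -kleinProduct z τ := by
  rw [kleinProduct_eq_mul _ hτ, kleinProduct_eq_mul _ hτ, mul_neg, one_sub_exp_neg, mul_neg,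
    sub_neg_eq_add, ← sub_eq_add_neg, neg_neg]
  have : exp (π * I * z) = exp (2 * π * I * z) * exp (-(π * I * z)) := by
    rw [← exp_add]; ring_nf
  rw [this]
  have h2 : exp (-(2 * π * I * z)) * exp (2 * π * I * z) = 1 := by
    rw [← exp_add, neg_add_cancel, exp_zero]
  linear_combination (-(1 - exp (2 * π * I * z)) * (exp (-(π * I * z)) *
      (qPochhammerInf (exp (2 * π * I * (τ + z))) (exp (2 * π * I * τ)) *
        qPochhammerInf (exp (2 * π * I * (τ - z))) (exp (2 * π * I * τ))) /
          qPochhammerInf (exp (2 * π * I * τ)) (exp (2 * π * I * τ)) ^ 2)) * h2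

theorem kleinProduct_add_period (z : ℂ) {τ : ℂ} (hτ : 0 < τ.im) :
    kleinProduct (z + τ) τ = -exp (-(2 * π * I * z + π * I * τ)) * kleinProduct z τ := by
  rw [kleinProduct_eq_mul z hτ, kleinProduct, sub_add_cancel_right,
    qPochhammerInf_eq_mul (exp (2 * π * I * -z)) (norm_exp_two_pi_I_mul_lt_one hτ), ← exp_add,
    ← mul_add, neg_add_eq_sub, add_comm z τ, mul_neg, one_sub_exp_neg]
  have : exp (-(π * I * (τ + z))) * exp (-(2 * π * I * z)) =
      exp (-(2 * π * I * z + π * I * τ)) * exp (-(π * I * z)) := by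
    rw [← exp_add, ← exp_add]; ring_nf
  linear_combination (-(1 - exp (2 * π * I * z)) *
      (qPochhammerInf (exp (2 * π * I * (τ + z))) (exp (2 * π * I * τ)) *
        qPochhammerInf (exp (2 * π * I * (τ - z))) (exp (2 * π * I * τ))) /
          qPochhammerInf (exp (2 * π * I * τ)) (exp (2 * π * I * τ)) ^ 2) * this

theorem kleinProduct_zero (τ : ℂ) (hτ : 0 < τ.im) : kleinProduct 0 τ = 0 := by
  simp [kleinProduct_eq_mul 0 hτ]

theorem kleinProduct_eq_zero_iff (z : ℂ) {τ : ℂ} (hτ : 0 < τ.im) :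
    kleinProduct z τ = 0 ↔ ∃ m n : ℤ, z = m + n * τ := by
  have hq := norm_exp_two_pi_I_mul_lt_one hτ
  constructor
  · intro h
    by_contra! hz
    refine div_ne_zero (mul_ne_zero (exp_ne_zero _) (mul_ne_zero ?_ ?_))
      (pow_ne_zero 2 (qPochhammerInf_ne_zero_of_norm_lt hq hq)) h
    · refine qPochhammerInf_ne_zero hq fun n hn ↦ ?_
      rw [← exp_nat_mul, ← exp_add, mul_left_comm, ← mul_add, exp_two_pi_I_mul_eq_one_iff] at hn
      obtain ⟨m, hm⟩ := hn
      refine hz m (-n) ?_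
      push_cast
      linear_combination hm
    · refine qPochhammerInf_ne_zero hq fun n hn ↦ ?_
      rw [← exp_nat_mul, ← exp_add, mul_left_comm, ← mul_add, exp_two_pi_I_mul_eq_one_iff] at hn
      obtain ⟨m, hm⟩ := hn
      refine hz (-m) (n + 1) ?_
      push_cast
      linear_combination -hm
  · rintro ⟨m, n, rfl⟩
    have h1 : ∀ w, kleinProduct (w + 1) τ = 0 ↔ kleinProduct w τ = 0 := fun w ↦ by
      rw [kleinProduct_add_one, neg_eq_zero]
    have h2 : ∀ w, kleinProduct (w + τ) τ = 0 ↔ kleinProduct w τ = 0 := fun w ↦ by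
      rw [kleinProduct_add_period w hτ, mul_eq_zero_iff_left (by simp [exp_ne_zero])]
    have h3 : kleinProduct m τ = 0 := by
      induction m with
      | zero => simpa using kleinProduct_zero τ hτ
      | succ i ih => simpa [h1] using ih
      | pred i ih =>
        rw [← h1]
        simpa using ih
    induction n with
    | zero => simpa using h3
    | succ i ih =>
      rw [← h2] at ih
      rw [← ih]; push_cast; ring_nf
    | pred i ih =>
      rw [← h2, ← ih]; push_cast; ring_nf

theorem differentiable_qPochhammerInf {a : ℂ → ℂ} (ha : Differentiable ℂ a) {q : ℂ}
    (hq : ‖q‖ < 1) : Differentiable ℂ fun z ↦ qPochhammerInf (a z) q := by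
  rw [← differentiableOn_univ]
  exact differentiableOn_qPochhammerInf isOpen_univ ha.differentiableOn
    (differentiableOn_const q) fun _ _ ↦ hq

theorem differentiable_kleinProduct {τ : ℂ} (hτ : 0 < τ.im) :
    Differentiable ℂ fun z ↦ kleinProduct z τ := by
  have hq := norm_exp_two_pi_I_mul_lt_one hτ
  exact .div_const (.mul (by fun_prop) (.mul (differentiable_qPochhammerInf (by fun_prop) hq)
    (differentiable_qPochhammerInf (by fun_prop) hq))) _

/-- The division by (q; q)^2 makes this derivative independent of τ, which is why no eta factor
appears in the inversion formula. -/
theorem hasDerivAt_kleinProduct_zero {τ : ℂ} (hτ : 0 < τ.im) :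
    HasDerivAt (fun z ↦ kleinProduct z τ) (-(2 * π * I)) 0 := by
  have hq := norm_exp_two_pi_I_mul_lt_one hτ
  have h0 := qPochhammerInf_ne_zero_of_norm_lt hq hq
  simp_rw [kleinProduct_eq_mul _ hτ]
  have h1 : HasDerivAt (fun z ↦ 1 - exp (2 * π * I * z)) (-(2 * π * I)) 0 := by
    simpa using (((hasDerivAt_id (0 : ℂ)).const_mul (2 * π * I)).cexp.const_sub 1)
  have h2 : DifferentiableAt ℂ (fun z ↦ (exp (-(π * I * z)) *
      (qPochhammerInf (exp (2 * π * I * (τ + z))) (exp (2 * π * I * τ)) *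
        qPochhammerInf (exp (2 * π * I * (τ - z))) (exp (2 * π * I * τ))) /
          qPochhammerInf (exp (2 * π * I * τ)) (exp (2 * π * I * τ)) ^ 2)) 0 :=
    .div_const (.mul (by fun_prop) (.mul (differentiable_qPochhammerInf (by fun_prop) hq 0)
      (differentiable_qPochhammerInf (by fun_prop) hq 0))) _
  have h3 := h1.mul h2.hasDerivAt
  refine h3.congr_deriv ?_
  simp only [mul_zero, neg_zero, exp_zero, add_zero, sub_zero, sub_self, zero_mul, one_mul]
  field_simp

theorem exists_add_mul_eq {τ : ℂ} (hτ : 0 < τ.im) (z : ℂ) : ∃ x y : ℝ, z = x + y * τ := by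
  refine ⟨z.re - z.im / τ.im * τ.re, z.im / τ.im, ?_⟩
  apply Complex.ext
  · simp
  · simp [hτ.ne']

/-- An entire function with the periods `1` and `τ` is constant. -/
theorem Differentiable.apply_eq_apply_of_doubly_periodic {f : ℂ → ℂ} (hf : Differentiable ℂ f)
    {τ : ℂ} (hτ : 0 < τ.im) (h1 : f.Periodic 1) (h2 : f.Periodic τ) (z w : ℂ) : f z = f w := by
  refine hf.apply_eq_apply_of_bounded ?_ z w
  let p : ℝ × ℝ → ℂ := fun x ↦ x.1 + x.2 * τ
  have hK : IsCompact (p '' (Set.Icc 0 1 ×ˢ Set.Icc 0 1)) :=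
    (isCompact_Icc.prod isCompact_Icc).image (by fun_prop)
  refine (hK.image hf.continuous).isBounded.subset ?_
  rintro _ ⟨u, rfl⟩
  obtain ⟨x, y, rfl⟩ := exists_add_mul_eq hτ u
  refine ⟨_, ⟨(Int.fract x, Int.fract y), ⟨⟨Int.fract_nonneg x, (Int.fract_lt_one x).le⟩,
    ⟨Int.fract_nonneg y, (Int.fract_lt_one y).le⟩⟩, rfl⟩, ?_⟩
  have h1' := h1.int_mul ⌊x⌋
  have h2' := h2.int_mul ⌊y⌋
  rw [← h1', ← h2']
  congr 1
  simp only [p, Int.fract]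
  push_cast
  ring

theorem neg_inv_im_pos {τ : ℂ} (hτ : 0 < τ.im) : 0 < (-1 / τ).im := by
  have := (UpperHalfPlane.mk (-τ)⁻¹ (UpperHalfPlane.im_inv_neg_coe_pos ⟨τ, hτ⟩)).2
  simpa [neg_div, inv_neg] using this

theorem kleinProduct_sub_period (z : ℂ) {τ : ℂ} (hτ : 0 < τ.im) :
    kleinProduct (z - τ) τ = -exp (2 * π * I * z - π * I * τ) * kleinProduct z τ := by
  have h := kleinProduct_add_period (z - τ) hτ
  rw [sub_add_cancel] at h
  rw [h, ← mul_assoc, neg_mul_neg, ← exp_add]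
  ring_nf
  simp

/-- The Jacobi transformation `τ ↦ -1 / τ` of `kleinProduct`. -/
theorem kleinProduct_neg_inv (z : ℂ) {τ : ℂ} (hτ : 0 < τ.im) :
    kleinProduct (z / τ) (-1 / τ) = τ⁻¹ * exp (π * I * z ^ 2 / τ) * kleinProduct z τ := by
  have hτ' := neg_inv_im_pos hτ
  have hτ0 : τ ≠ 0 := fun h ↦ by simp [h] at hτ
  set τ' := -1 / τ with hτ'_def
  -- The numerator has the same quasi-periods and zeros as the denominator, so `h` is doubly
  -- periodic with removable singularities. `f` fills them with the limit at 0, the ratio of the two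
  -- derivatives there, and is constant by Liouville.
  let h : ℂ → ℂ := fun z ↦ kleinProduct (z / τ) τ' * exp (-(π * I * z ^ 2 / τ)) / kleinProduct z τ
  let f : ℂ → ℂ := fun z ↦ if kleinProduct z τ = 0 then τ⁻¹ else h z
  have hz1 : ∀ w, kleinProduct (w + 1) τ = 0 ↔ kleinProduct w τ = 0 := fun w ↦ by
    rw [kleinProduct_add_one, neg_eq_zero]
  have hz2 : ∀ w, kleinProduct (w + τ) τ = 0 ↔ kleinProduct w τ = 0 := fun w ↦ by
    rw [kleinProduct_add_period w hτ, mul_eq_zero_iff_left (by simp [exp_ne_zero])]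
  have hf1 : f.Periodic 1 := fun w ↦ by
    simp only [f, hz1]
    split_ifs with hw
    · rfl
    · have h1 : (w + 1) / τ = w / τ - τ' := by rw [hτ'_def]; ring
      simp only [h]
      rw [h1, kleinProduct_sub_period _ hτ', kleinProduct_add_one, neg_mul, neg_mul,
        neg_div_neg_eq, mul_right_comm, ← exp_add, mul_comm (exp _)]
      congr 3
      rw [hτ'_def]
      field_simp
      ring
  have hf2 : f.Periodic τ := fun w ↦ by
    simp only [f, hz2]
    split_ifs with hw
    · rfl
    · have h1 : (w + τ) / τ = w / τ + 1 := by field_simp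
      simp only [h]
      rw [h1, kleinProduct_add_one, kleinProduct_add_period _ hτ, neg_mul, neg_mul,
        neg_div_neg_eq, div_eq_div_iff (mul_ne_zero (exp_ne_zero _) hw) hw]
      have : exp (-(π * I * (w + τ) ^ 2 / τ)) =
          exp (-(π * I * w ^ 2 / τ)) * exp (-(2 * π * I * w + π * I * τ)) := by
        rw [← exp_add]
        congr 1
        field_simp
        ring
      rw [this]
      ring
  have hd := differentiable_kleinProduct hτ
  have hd' : Differentiable ℂ fun z ↦ kleinProduct (z / τ) τ' :=
    (differentiable_kleinProduct hτ').comp (differentiable_id.div_const τ)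
  have hreg : ∀ w, kleinProduct w τ ≠ 0 → DifferentiableAt ℂ f w := fun w hw ↦ by
    have h1 : DifferentiableAt ℂ h w := ((hd' w).mul (by fun_prop)).div (hd w) hw
    refine h1.congr_of_eventuallyEq ?_
    filter_upwards [hd.continuous.continuousAt.eventually_ne hw] with u hu
    simp [f, hu]
  have h0 := kleinProduct_zero τ hτ
  have hpunct : ∀ᶠ w in nhdsWithin 0 {(0 : ℂ)}ᶜ, kleinProduct w τ ≠ 0 := by
    exact (hasDerivAt_kleinProduct_zero hτ).eventually_ne (by simp)
  have hlim : Filter.Tendsto h (nhdsWithin 0 {(0 : ℂ)}ᶜ) (nhds τ⁻¹) := by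
    have e1 : HasDerivAt (fun z ↦ kleinProduct (z / τ) τ') (-(2 * π * I) * (1 / τ)) 0 := by
      have := hasDerivAt_kleinProduct_zero hτ'
      rw [← zero_div τ] at this
      exact this.comp (0 : ℂ) ((hasDerivAt_id (0 : ℂ)).div_const τ)
    have e2 := e1.tendsto_slope.div (hasDerivAt_kleinProduct_zero hτ).tendsto_slope (by simp)
    have e3 : Filter.Tendsto (fun z : ℂ ↦ exp (-(π * I * z ^ 2 / τ))) (nhdsWithin 0 {(0 : ℂ)}ᶜ)
        (nhds 1) := by
      have : ContinuousAt (fun z : ℂ ↦ exp (-(π * I * z ^ 2 / τ))) 0 := by fun_prop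
      simpa using this.tendsto.mono_left nhdsWithin_le_nhds
    have e4 := e2.mul e3
    rw [mul_one, mul_div_cancel_left₀ _ (by simp), one_div] at e4
    refine e4.congr' ?_
    filter_upwards [hpunct, self_mem_nhdsWithin] with w hw hw0
    have hw0 : w ≠ 0 := hw0
    simp only [Pi.div_apply, slope_def_field, zero_div, kleinProduct_zero τ' hτ', h0, sub_zero, h]
    field_simp
  have hcont : ContinuousAt f 0 := by
    rw [continuousAt_iff_punctured_nhds]
    have : f 0 = τ⁻¹ := by simp [f, h0]
    rw [this]
    refine hlim.congr' ?_
    filter_upwards [hpunct] with w hw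
    simp [f, hw]
  -- Removable singularity at 0; periodicity then carries it to every lattice point.
  have hf0 : DifferentiableAt ℂ f 0 :=
    (analyticAt_of_differentiable_on_punctured_nhds_of_continuousAt
      (hpunct.mono hreg) hcont).differentiableAt
  have hf : Differentiable ℂ f := fun w ↦ by
    by_cases hw : kleinProduct w τ = 0
    · obtain ⟨m, n, rfl⟩ := (kleinProduct_eq_zero_iff w hτ).1 hw
      have e : f = fun z ↦ f (z - (m + n * τ)) := by
        ext z
        rw [← sub_sub, (hf2.int_mul n).sub_eq, ← mul_one (m : ℂ), (hf1.int_mul m).sub_eq]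
      rw [e]
      refine DifferentiableAt.comp _ (g := f) ?_ (by fun_prop)
      rwa [sub_self]
    · exact hreg w hw
  have key := hf.apply_eq_apply_of_doubly_periodic hτ hf1 hf2 z 0
  have hf00 : f 0 = τ⁻¹ := by simp [f, h0]
  rw [hf00] at key
  by_cases hz : kleinProduct z τ = 0
  · rw [hz, mul_zero, kleinProduct_eq_zero_iff _ hτ']
    obtain ⟨m, n, rfl⟩ := (kleinProduct_eq_zero_iff z hτ).1 hz
    refine ⟨n, -m, ?_⟩
    rw [hτ'_def]
    push_cast
    field_simp
    ring
  · simp only [f, hz, if_false, h] at key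
    rw [div_eq_iff hz, exp_neg] at key
    field_simp at key ⊢
    linear_combination key

/-! ### Klein forms: shifts of the characteristic and the action of SL(2, ℤ). -/

/-- The Klein form with characteristic `(a, b)`. -/
noncomputable def kleinForm (a b τ : ℂ) : ℂ :=
  exp (π * I * (a * (a * τ + b))) * kleinProduct (a * τ + b) τ

theorem kleinForm_neg (a b : ℂ) {τ : ℂ} (hτ : 0 < τ.im) :
    kleinForm (-a) (-b) τ = -kleinForm a b τ := by
  have : -a * τ + -b = -(a * τ + b) := by ring
  rw [kleinForm, this, kleinProduct_neg _ hτ, neg_mul_neg, mul_neg, kleinForm]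

theorem kleinForm_add_one_right (a b τ : ℂ) :
    kleinForm a (b + 1) τ = -exp (π * I * a) * kleinForm a b τ := by
  rw [kleinForm, kleinForm, ← add_assoc, kleinProduct_add_one, mul_add a, mul_one, mul_add (π * I),
    exp_add]
  ring

theorem kleinForm_add_one_left (a b : ℂ) {τ : ℂ} (hτ : 0 < τ.im) :
    kleinForm (a + 1) b τ = -exp (-(π * I * b)) * kleinForm a b τ := by
  have h1 : (a + 1) * τ + b = a * τ + b + τ := by ring
  rw [kleinForm, h1, kleinProduct_add_period _ hτ, kleinForm, ← mul_assoc, mul_neg, ← exp_add,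
    ← mul_assoc, neg_mul (exp (-(π * I * b))), ← mul_assoc, ← exp_add]
  ring_nf

theorem kleinForm_add_int_right (a b τ : ℂ) (n : ℤ) :
    kleinForm a (b + n) τ = (-1) ^ n * exp (π * I * (a * n)) * kleinForm a b τ := by
  induction n with
  | zero => simp
  | succ i ih =>
    push_cast at ih ⊢
    rw [← add_assoc, kleinForm_add_one_right, ih, zpow_add_one₀ (by simp), mul_add a, mul_one,
      mul_add (π * I), exp_add]
    ring
  | pred i ih =>
    have h := kleinForm_add_one_right a (b + (-i - 1)) τ
    push_cast at ih ⊢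
    rw [← add_sub_assoc, sub_add_cancel, ih] at h
    rw [← mul_right_inj' (neg_ne_zero.2 (exp_ne_zero (π * I * a))), ← add_sub_assoc, ← h,
      zpow_sub_one₀ (by simp), mul_sub a, mul_one, mul_sub (π * I), exp_sub]
    field_simp [exp_ne_zero]

theorem kleinForm_add_int_left (a b : ℂ) {τ : ℂ} (hτ : 0 < τ.im) (n : ℤ) :
    kleinForm (a + n) b τ = (-1) ^ n * exp (-(π * I * (b * n))) * kleinForm a b τ := by
  induction n with
  | zero => simp
  | succ i ih =>
    push_cast at ih ⊢
    rw [← add_assoc, kleinForm_add_one_left _ _ hτ, ih, zpow_add_one₀ (by simp), mul_add b, mul_one,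
      mul_add (π * I), neg_add, exp_add]
    ring
  | pred i ih =>
    have h := kleinForm_add_one_left (a + (-i - 1)) b hτ
    push_cast at ih ⊢
    rw [← add_sub_assoc, sub_add_cancel, ih] at h
    rw [← mul_right_inj' (neg_ne_zero.2 (exp_ne_zero (-(π * I * b)))), ← add_sub_assoc, ← h,
      zpow_sub_one₀ (by simp), mul_sub b, mul_one, mul_sub (π * I), neg_sub, exp_sub, exp_neg,
      exp_neg]
    field_simp [exp_ne_zero]

theorem exp_pi_mul_I_mul_int (n : ℤ) : exp (π * I * n) = (-1) ^ n := by
  rw [mul_comm, exp_int_mul, exp_pi_mul_I]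

theorem exp_neg_pi_mul_I_mul_int (n : ℤ) : exp (-(π * I * n)) = (-1) ^ n := by
  rw [exp_neg, exp_pi_mul_I_mul_int, ← inv_zpow, inv_neg_one]

theorem kleinForm_add_int (a b : ℂ) {τ : ℂ} (hτ : 0 < τ.im) (m n : ℤ) :
    kleinForm (a + m) (b + n) τ =
      (-1) ^ (m + n + m * n) * exp (π * I * (a * n - b * m)) * kleinForm a b τ := by
  -- The left shift is made at b + n, whence the cross term (-1)^(mn).
  have h : exp (-(π * I * ((b + n) * m))) = (-1) ^ (m * n) * exp (-(π * I * (b * m))) := by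
    rw [← exp_neg_pi_mul_I_mul_int, ← exp_add]
    push_cast
    ring_nf
  rw [kleinForm_add_int_left _ _ hτ, kleinForm_add_int_right, h, zpow_add₀ (by simp),
    zpow_add₀ (by simp), mul_sub, sub_eq_add_neg (π * I * (a * n)), exp_add]
  ring

theorem coe_SL2Z_smul (B : SL(2, ℤ)) (τ : ℍ) : ((B • τ : ℍ) : ℂ) =
    ((B 0 0 : ℂ) * τ + (B 0 1 : ℂ)) / ((B 1 0 : ℂ) * τ + (B 1 1 : ℂ)) := by
  rw [coe_specialLinearGroup_apply]
  simp

theorem SL2Z_denom_ne_zero (B : SL(2, ℤ)) (τ : ℍ) : (B 1 0 : ℂ) * τ + (B 1 1 : ℂ) ≠ 0 := by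
  simpa [denom] using denom_ne_zero (B : GL (Fin 2) ℝ) τ

theorem SL2Z_denom_mul (A B : SL(2, ℤ)) (τ : ℍ) :
    ((A * B) 1 0 : ℂ) * τ + ((A * B) 1 1 : ℂ) =
      ((A 1 0 : ℂ) * (B • τ : ℍ) + (A 1 1 : ℂ)) * ((B 1 0 : ℂ) * τ + (B 1 1 : ℂ)) := by
  have h := div_mul_cancel₀ ((B 0 0 : ℂ) * τ + (B 0 1 : ℂ)) (SL2Z_denom_ne_zero B τ)
  rw [coe_SL2Z_smul]
  simp only [Matrix.SpecialLinearGroup.coe_mul, Matrix.mul_apply, Fin.sum_univ_two]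
  push_cast
  linear_combination -(A 1 0 : ℂ) * h

/-- It suffices to check S and T. For S the exponential prefactor of the Klein form absorbs the one
in Jacobi's inversion; for T the theta product is invariant. The quantification over (a, b) inside
the induction is needed because a product of matrices changes the characteristic. -/
theorem denom_mul_kleinForm_smul (B : SL(2, ℤ)) : ∀ (a b : ℂ) (τ : ℍ),
    ((B 1 0 : ℂ) * τ + (B 1 1 : ℂ)) * kleinForm a b ((B • τ : ℍ) : ℂ) =
      kleinForm (a * B 0 0 + b * B 1 0) (a * B 0 1 + b * B 1 1) τ := by
  have hB : B ∈ Subgroup.closure {ModularGroup.S, ModularGroup.T} := by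
    simp [SpecialLinearGroup.SL2Z_generators]
  induction hB using Subgroup.closure_induction with
  | mem x hx =>
    intro a b τ
    rcases hx with rfl | rfl
    · have h0 : (τ : ℂ) ≠ 0 := τ.ne_zero
      have h1 : a * (-1 / τ) + b = (b * τ - a) / τ := by field_simp; ring
      have h2 : ((ModularGroup.S • τ : ℍ) : ℂ) = -1 / τ := by
        rw [coe_SL2Z_smul]
        simp [ModularGroup.S]
      have h3 : exp (π * I * (a * ((b * τ - a) / τ))) * exp (π * I * (b * τ - a) ^ 2 / τ) =
          exp (π * I * (b * (b * τ - a))) := by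
        rw [← exp_add]
        congr 1
        field_simp
        ring
      have h4 : (τ : ℂ) * kleinForm a b (-1 / τ) = kleinForm b (-a) τ := by
        rw [kleinForm, h1, kleinProduct_neg_inv _ τ.2, kleinForm, ← sub_eq_add_neg, ← h3]
        field_simp
      rw [h2]
      simpa [ModularGroup.S] using h4
    · have h2 : ((ModularGroup.T • τ : ℍ) : ℂ) = τ + 1 := by
        rw [coe_SL2Z_smul]
        simp [ModularGroup.T]
      have h4 : kleinForm a b (τ + 1) = kleinForm a (a + b) τ := by
        rw [kleinForm, kleinProduct_add_one_right, kleinForm, mul_add a (τ : ℂ) 1, mul_one, add_assoc]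
      rw [h2]
      simpa [ModularGroup.T] using h4
  | one => simp
  | mul x y _ _ hx hy =>
    intro a b τ
    rw [SL2Z_denom_mul, mul_smul, mul_right_comm, hx, mul_comm, hy]
    congr 1 <;> simp [Matrix.mul_apply, Fin.sum_univ_two] <;> ring
  | inv x _ hx =>
    intro a b τ
    have h := hx (a * x⁻¹ 0 0 + b * x⁻¹ 1 0) (a * x⁻¹ 0 1 + b * x⁻¹ 1 1) (x⁻¹ • τ)
    rw [smul_inv_smul] at h
    have h2 := SL2Z_denom_mul x x⁻¹ τ
    have hdet : (x 0 0 : ℂ) * x 1 1 - x 0 1 * x 1 0 = 1 := by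
      have := x.det_coe
      rw [Matrix.det_fin_two] at this
      exact_mod_cast this
    simp only [mul_inv_cancel, Matrix.SpecialLinearGroup.coe_one, ne_eq, one_ne_zero,
      not_false_eq_true, Matrix.one_apply_ne, Matrix.one_apply_eq, Int.cast_zero, Int.cast_one,
      zero_mul, zero_add] at h2
    have e1 : (a * x⁻¹ 0 0 + b * x⁻¹ 1 0) * x 0 0 + (a * x⁻¹ 0 1 + b * x⁻¹ 1 1) * x 1 0 = a := by
      simp [Matrix.SpecialLinearGroup.coe_inv, Matrix.adjugate_fin_two]
      linear_combination a * hdet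
    have e2 : (a * x⁻¹ 0 0 + b * x⁻¹ 1 0) * x 0 1 + (a * x⁻¹ 0 1 + b * x⁻¹ 1 1) * x 1 1 = b := by
      simp [Matrix.SpecialLinearGroup.coe_inv, Matrix.adjugate_fin_two]
      linear_combination b * hdet
    rw [e1, e2] at h
    rw [← h, ← mul_assoc, mul_comm (((x⁻¹ : SL(2, ℤ)) 1 0 : ℂ) * _ + _), ← h2, one_mul]

theorem kleinForm_smul (B : SL(2, ℤ)) (a b : ℂ) (τ : ℍ) :
    kleinForm a b ((B • τ : ℍ) : ℂ) = ((B 1 0 : ℂ) * τ + (B 1 1 : ℂ))⁻¹ *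
      kleinForm (a * B 0 0 + b * B 1 0) (a * B 0 1 + b * B 1 1) τ := by
  rw [← denom_mul_kleinForm_smul, inv_mul_cancel_left₀ (SL2Z_denom_ne_zero B τ)]

/-! ### η and f_{N,ρ} in terms of Klein forms. -/

theorem eta_eq_exp_mul_qPochhammerInf (τ : ℂ) :
    η τ = exp (2 * π * I * τ / 24) * qPochhammerInf (exp (2 * π * I * τ)) (exp (2 * π * I * τ)) := by
  simp [ModularForm.eta, Function.Periodic.qParam, ModularForm.eta_q, qPochhammerInf, pow_succ']

/-- The cube of η turns (q^N; q^N)^(-2) into the first power. The exponent matches through (N -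
2ρ)²/(8N) = N/8 - ρ/2 + ρ²/(2N), the terms coming from η³, the theta product and the Klein
prefactor. -/
theorem generalizedEta_eq_kleinForm {N : ℕ} (hN : 0 < N) (ρ : ℤ) {τ : ℂ} (hτ : 0 < τ.im) :
    generalizedEta N ρ τ = kleinForm (ρ / N) 0 (N * τ) * η (N * τ) ^ 3 := by
  have hN0 : (N : ℂ) ≠ 0 := Nat.cast_ne_zero.2 hN.ne'
  have hNτ : 0 < ((N : ℂ) * τ).im := by simpa [hN] using hτ
  have hq := norm_exp_two_pi_I_mul_lt_one hNτ
  have h0 := qPochhammerInf_ne_zero_of_norm_lt hq hq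
  have h1 : (ρ / N : ℂ) * (N * τ) + 0 = ρ * τ := by field_simp; ring
  have h2 : exp (2 * π * I * τ * (((N : ℂ) - 2 * ρ) ^ 2 / (8 * N))) =
      exp (π * I * (ρ / N * (ρ * τ))) * exp (-(π * I * (ρ * τ))) *
        exp (2 * π * I * (N * τ) / 24) ^ 3 := by
    rw [← exp_nat_mul, ← exp_add, ← exp_add]
    congr 1
    push_cast
    field_simp
    ring
  have h3 : 2 * π * I * τ * ρ = 2 * π * I * (ρ * τ) := by ring
  have h4 : 2 * π * I * τ * (N - ρ) = 2 * π * I * (N * τ - ρ * τ) := by ring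
  have h5 : 2 * π * I * τ * N = 2 * π * I * (N * τ) := by ring
  rw [generalizedEta, kleinForm, h1, kleinProduct, eta_eq_exp_mul_qPochhammerInf, h2, h3, h4, h5]
  field_simp

theorem natCast_mul_im_pos {m : ℕ} (hm : 0 < m) (τ : ℍ) : 0 < ((m : ℂ) * τ).im := by
  simpa [hm] using τ.im_pos

theorem natCast_mul_smul {m : ℕ} (hm : 0 < m) (B : SL(2, ℤ)) (h : (m : ℤ) ∣ B 1 0) (τ : ℍ) :
    (m : ℂ) * ((B • τ : ℍ) : ℂ) =
      (scaledMatrix m B h • (⟨m * τ, natCast_mul_im_pos hm τ⟩ : ℍ) : ℍ) := by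
  have hm0 : (m : ℂ) ≠ 0 := Nat.cast_ne_zero.2 hm.ne'
  rw [coe_SL2Z_smul, coe_SL2Z_smul]
  obtain ⟨k, hk⟩ := h
  have hk' : (m : ℤ) * k / m = k := Int.mul_ediv_cancel_left _ (by exact_mod_cast hm.ne')
  simp only [scaledMatrix, Matrix.of_apply, Matrix.cons_val', Matrix.cons_val_zero,
    Matrix.cons_val_one, Matrix.cons_val_fin_one, hk', hk]
  push_cast
  rw [← mul_div_assoc]
  ring_nf

theorem scaledMatrix_denom {m : ℕ} (hm : 0 < m) (B : SL(2, ℤ)) (h : (m : ℤ) ∣ B 1 0) (τ : ℂ) :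
    (scaledMatrix m B h 1 0 : ℂ) * (m * τ) + (scaledMatrix m B h 1 1 : ℂ) =
      (B 1 0 : ℂ) * τ + (B 1 1 : ℂ) := by
  obtain ⟨k, hk⟩ := h
  have hk' : (m : ℤ) * k / m = k := Int.mul_ediv_cancel_left _ (by exact_mod_cast hm.ne')
  simp only [scaledMatrix, Matrix.of_apply, Matrix.cons_val', Matrix.cons_val_zero,
    Matrix.cons_val_one, Matrix.cons_val_fin_one, hk', hk]
  push_cast
  ring

theorem eta_natCast_mul_smul {m : ℕ} (hm : 0 < m) (B : SL(2, ℤ)) (h : (m : ℤ) ∣ B 1 0) (τ : ℍ) :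
    η ((m : ℂ) * ((B • τ : ℍ) : ℂ)) = etaMultiplier (scaledMatrix m B h) *
      ((B 1 0 : ℂ) * τ + (B 1 1 : ℂ)) ^ (1 / 2 : ℂ) * η (m * τ) := by
  rw [natCast_mul_smul hm B h, eta_smul_eq_etaMultiplier, scaledMatrix_denom hm]

theorem cpow_half_mul_self (x : ℂ) : x ^ (1 / 2 : ℂ) * x ^ (1 / 2 : ℂ) = x := by
  rw [← sq, ← cpow_nat_mul]
  norm_num

/-- The transformation of `f_{N, ρ}` under a matrix of `Γ₀(N)` with `ρ α ≡ ρ (mod N)`. -/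
theorem generalizedEta_smul {N : ℕ} (hN : 0 < N) (ρ m : ℤ) (B : SL(2, ℤ)) (h : (N : ℤ) ∣ B 1 0)
    (hm : ρ * (B 0 0 - 1) = N * m) (τ : ℍ) :
    generalizedEta N ρ ((B • τ : ℍ) : ℂ) =
      (-1) ^ (m + ρ * B 0 1 + m * (ρ * B 0 1)) * exp (π * I * (ρ ^ 2 * B 0 1 / N)) *
        etaMultiplier (scaledMatrix N B h) ^ 3 *
          ((B 1 0 : ℂ) * τ + (B 1 1 : ℂ)) ^ (1 / 2 : ℂ) * generalizedEta N ρ τ := by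
  have hN0 : (N : ℂ) ≠ 0 := Nat.cast_ne_zero.2 hN.ne'
  have hx := SL2Z_denom_ne_zero B τ
  have hsq := cpow_half_mul_self ((B 1 0 : ℂ) * τ + (B 1 1 : ℂ))
  rw [generalizedEta_eq_kleinForm hN _ (B • τ).im_pos, eta_natCast_mul_smul hN B h,
    natCast_mul_smul hN B h, kleinForm_smul, scaledMatrix_denom hN,
    generalizedEta_eq_kleinForm hN _ τ.im_pos]
  have h1 : (ρ / N : ℂ) * scaledMatrix N B h 0 0 + 0 * scaledMatrix N B h 1 0 = ρ / N + m := by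
    have : (ρ : ℂ) * (B 0 0 - 1) = N * m := by exact_mod_cast hm
    simp only [scaledMatrix, Matrix.of_apply, Matrix.cons_val', Matrix.cons_val_zero,
      Matrix.cons_val_fin_one]
    field_simp
    linear_combination this
  have h2 : (ρ / N : ℂ) * scaledMatrix N B h 0 1 + 0 * scaledMatrix N B h 1 1 =
      0 + (ρ * B 0 1 : ℤ) := by
    simp only [scaledMatrix, Matrix.of_apply, Matrix.cons_val', Matrix.cons_val_zero,
      Matrix.cons_val_fin_one, Matrix.cons_val_one]
    push_cast
    field_simp
    ring
  rw [h1, h2, kleinForm_add_int _ _ (natCast_mul_im_pos hN τ)]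
  have h3 : (ρ / N : ℂ) * (ρ * B 0 1 : ℤ) - 0 * m = ρ ^ 2 * B 0 1 / N := by
    push_cast
    ring
  rw [h3]
  -- With s the square root of γτ + δ, the Klein form contributes s^(-2) and the cube of η
  -- contributes s^3.
  generalize ((B 1 0 : ℂ) * τ + (B 1 1 : ℂ)) ^ (1 / 2 : ℂ) = s at *
  rw [← hsq] at hx ⊢
  field_simp [left_ne_zero_of_mul hx]

/-! ### The eta multiplier of B_M for odd M, by Gauss's lemma. -/

theorem one_sub_pow_eq_prod_range {M : ℕ} {ζ : ℂ} (hζ : IsPrimitiveRoot ζ M) (hM : 0 < M) (x : ℂ) :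
    1 - x ^ M = ∏ j ∈ Finset.range M, (1 - ζ ^ j * x) := by
  have h := hζ.pow_sub_pow_eq_prod_sub_mul 1 x hM
  rw [one_pow] at h
  rw [h]
  symm
  refine Finset.prod_nbij (ζ ^ ·) (fun j _ ↦ ?_) (fun i hi j hj hij ↦ ?_) (fun ξ hξ ↦ ?_)
    fun _ _ ↦ rfl
  · rw [Polynomial.mem_nthRootsFinset hM, ← pow_mul, mul_comm, pow_mul, hζ.pow_eq_one, one_pow]
  · exact hζ.pow_inj (by simpa using hi) (by simpa using hj) hij
  · have : NeZero M := ⟨hM.ne'⟩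
    obtain ⟨i, hi, rfl⟩ := hζ.eq_pow_of_pow_eq_one
      ((Polynomial.mem_nthRootsFinset hM _).1 (by simpa using hξ))
    exact ⟨i, by simpa using hi, rfl⟩

/-- The factors of `1 - x ^ M`, `M` odd, other than `1 - x`, grouped into pairs. -/
theorem one_sub_mul_prod_Icc {h : ℕ} {ζ : ℂ} (hζ : IsPrimitiveRoot ζ (2 * h + 1)) (x : ℂ) :
    (1 - x) * ∏ j ∈ Finset.Icc 1 h, ((1 - ζ ^ j * x) * (1 - (ζ ^ j)⁻¹ * x)) =
      1 - x ^ (2 * h + 1) := by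
  rw [one_sub_pow_eq_prod_range hζ (by omega), Finset.prod_range_succ', pow_zero, one_mul,
    mul_comm (1 - x), two_mul, Finset.prod_range_add, Finset.prod_mul_distrib,
    ← Finset.prod_range_reflect (fun i ↦ 1 - ζ ^ (h + i + 1) * x)]
  have e : Finset.Icc 1 h = Finset.Ico 1 (h + 1) := by ext; simp
  simp_rw [e, Finset.prod_Ico_eq_prod_range, Nat.add_sub_cancel]
  congr 2
  · exact Finset.prod_congr rfl fun j _ ↦ by rw [add_comm]
  · refine Finset.prod_congr rfl fun j hj ↦ ?_
    have hj := Finset.mem_range.1 hj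
    congr 2
    refine inv_eq_of_mul_eq_one_right ?_
    rw [← pow_add, show 1 + j + (h + (h - 1 - j) + 1) = 2 * h + 1 by omega, hζ.pow_eq_one]

theorem qPochhammerInf_self_mul_prod {h : ℕ} {ζ : ℂ} (hζ : IsPrimitiveRoot ζ (2 * h + 1)) {q : ℂ}
    (hq : ‖q‖ < 1) :
    qPochhammerInf q q * ∏ j ∈ Finset.Icc 1 h,
      (qPochhammerInf (ζ ^ j * q) q * qPochhammerInf ((ζ ^ j)⁻¹ * q) q) =
        qPochhammerInf (q ^ (2 * h + 1)) (q ^ (2 * h + 1)) := by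
  have m (a : ℂ) := multipliable_one_sub_mul_pow a hq
  simp only [qPochhammerInf]
  have e : ∀ j ∈ Finset.Icc 1 h, (∏' n : ℕ, (1 - ζ ^ j * q * q ^ n)) *
      (∏' n : ℕ, (1 - (ζ ^ j)⁻¹ * q * q ^ n)) =
        ∏' n : ℕ, ((1 - ζ ^ j * q * q ^ n) * (1 - (ζ ^ j)⁻¹ * q * q ^ n)) := fun j _ ↦
    ((m _).tprod_mul (m _)).symm
  rw [Finset.prod_congr rfl e, ← Multipliable.tprod_finsetProd fun j _ ↦ (m _).mul (m _),
    ← Multipliable.tprod_mul (m _) (multipliable_prod fun j _ ↦ (m _).mul (m _))]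
  refine tprod_congr fun n ↦ ?_
  have := one_sub_mul_prod_Icc hζ (q * q ^ n)
  simp only [← mul_assoc] at this
  rw [this]
  ring

/-- `η(Mτ)` as a product of Klein forms, for odd `M`. -/
theorem exists_mul_eta_eq_prod_kleinForm (h : ℕ) : ∃ C : ℂ, C ≠ 0 ∧ ∀ τ : ℂ, 0 < τ.im →
    C * η ((2 * h + 1 : ℕ) * τ) =
      η τ ^ (2 * h + 1) * ∏ j ∈ Finset.Icc 1 h, kleinForm 0 (j / (2 * h + 1 : ℕ)) τ := by
  set M : ℕ := 2 * h + 1 with hM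
  have hM0 : (M : ℂ) ≠ 0 := Nat.cast_ne_zero.2 (by omega)
  -- C gathers the factors of the Klein forms at j/M that do not depend on τ. None vanishes, since 0
  -- < j/M < 1.
  refine ⟨∏ j ∈ Finset.Icc 1 h, ((1 - exp (2 * π * I * (j / M))) * exp (-(π * I * (j / M)))),
    ?_, fun τ hτ ↦ ?_⟩
  · refine Finset.prod_ne_zero_iff.2 fun j hj ↦ mul_ne_zero ?_ (exp_ne_zero _)
    rw [sub_ne_zero, ne_comm, Ne, exp_two_pi_I_mul_eq_one_iff]
    rintro ⟨n, hn⟩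
    rw [div_eq_iff hM0] at hn
    have hn : (j : ℤ) = n * M := by exact_mod_cast hn
    have h1 := Finset.mem_Icc.1 hj
    have := Int.le_of_dvd (by omega) (Dvd.intro_left _ hn.symm)
    omega
  · have hζ := isPrimitiveRoot_exp M (by omega)
    have hq := norm_exp_two_pi_I_mul_lt_one hτ
    have h0 := qPochhammerInf_ne_zero_of_norm_lt hq hq
    have key := qPochhammerInf_self_mul_prod hζ hq
    set q := exp (2 * π * I * τ) with hq_def
    have e1 : exp (2 * π * I * (M * τ)) = q ^ M := by
      rw [hq_def, ← exp_nat_mul]; ring_nf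
    have e2 : exp (2 * π * I * (M * τ) / 24) = exp (2 * π * I * τ / 24) ^ M := by
      rw [← exp_nat_mul]; ring_nf
    have e3 : ∀ j ∈ Finset.Icc 1 h, kleinForm 0 (j / M) τ =
        (1 - exp (2 * π * I * (j / M))) * exp (-(π * I * (j / M))) *
          (qPochhammerInf (exp (2 * π * I / M) ^ j * q) q *
            qPochhammerInf ((exp (2 * π * I / M) ^ j)⁻¹ * q) q) * (qPochhammerInf q q ^ 2)⁻¹ := by
      intro j _
      have e4 : exp (2 * π * I * (τ + j / M)) = exp (2 * π * I / M) ^ j * q := by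
        rw [hq_def, ← exp_nat_mul, ← exp_add]; ring_nf
      have e5 : exp (2 * π * I * (τ - j / M)) = (exp (2 * π * I / M) ^ j)⁻¹ * q := by
        rw [hq_def, ← exp_nat_mul, ← exp_neg, ← exp_add]; ring_nf
      rw [kleinForm, zero_mul, zero_mul, mul_zero, exp_zero, one_mul, zero_add,
        kleinProduct_eq_mul _ hτ, e4, e5]
      ring
    have e7 := Finset.prod_congr rfl e3
    rw [Finset.prod_mul_distrib, Finset.prod_mul_distrib, Finset.prod_const, Nat.card_Icc,
      Nat.add_sub_cancel] at e7
    rw [e7, eta_eq_exp_mul_qPochhammerInf,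
      eta_eq_exp_mul_qPochhammerInf, e1, e2, ← key, ← hq_def, inv_pow, ← pow_mul]
    have e6 : qPochhammerInf q q ^ M = qPochhammerInf q q ^ (2 * h) * qPochhammerInf q q := by
      rw [hM, pow_succ]
    rw [mul_pow, e6]
    generalize (∏ j ∈ Finset.Icc 1 h,
      ((1 - exp (2 * π * I * (j / M))) * exp (-(π * I * (j / M))))) = A
    generalize (∏ j ∈ Finset.Icc 1 h, (qPochhammerInf (exp (2 * π * I / M) ^ j * q) q *
      qPochhammerInf ((exp (2 * π * I / M) ^ j)⁻¹ * q) q)) = A'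
    field_simp

/-- The sign in Gauss's lemma: the product of the signs of the absolutely least residues of
`d j` modulo `M` for `1 ≤ j ≤ M / 2`. -/
def gaussSign (M : ℕ) (d : ℤ) : ℤ :=
  ∏ j ∈ Finset.Icc 1 (M / 2), ((d * j : ZMod M).valMinAbs).sign

theorem isCoprime_mul_natCast_ne_zero {M : ℕ} {d : ℤ} (hd : IsCoprime (M : ℤ) d) {j : ℕ}
    (h0 : 0 < j) (h1 : j < M) : (d * j : ZMod M) ≠ 0 := by
  intro h
  have h2 : ((d * j : ℤ) : ZMod M) = 0 := by exact_mod_cast h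
  rw [ZMod.intCast_zmod_eq_zero_iff_dvd] at h2
  have := Nat.le_of_dvd h0 (Int.natCast_dvd_natCast.1 (hd.dvd_of_dvd_mul_left h2))
  omega

theorem gaussSign_sq {M : ℕ} {d : ℤ} (hd : IsCoprime (M : ℤ) d) : gaussSign M d ^ 2 = 1 := by
  rw [gaussSign, ← Finset.prod_pow]
  refine Finset.prod_eq_one fun j hj ↦ ?_
  have hj := Finset.mem_Icc.1 hj
  have h := isCoprime_mul_natCast_ne_zero hd (j := j) (by omega) (by omega)
  rw [Ne, ← ZMod.valMinAbs_eq_zero] at h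
  rw [← Int.natAbs_sq, Int.natAbs_sign_of_ne_zero h]
  rfl

/-- The absolutely least residues of `d j` permute `1, …, M / 2`, up to sign. -/
theorem bijOn_natAbs_valMinAbs {M : ℕ} (hM : Odd M) {d : ℤ} (hd : IsCoprime (M : ℤ) d) :
    Set.BijOn (fun j : ℕ ↦ (d * j : ZMod M).valMinAbs.natAbs) (Finset.Icc 1 (M / 2))
      (Finset.Icc 1 (M / 2)) := by
  have : NeZero M := ⟨hM.pos.ne'⟩
  have hmaps : Set.MapsTo (fun j : ℕ ↦ (d * j : ZMod M).valMinAbs.natAbs) (Finset.Icc 1 (M / 2))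
      (Finset.Icc 1 (M / 2)) := fun j hj ↦ by
    have hj := Finset.mem_Icc.1 hj
    have h := isCoprime_mul_natCast_ne_zero hd (j := j) (by omega) (by omega)
    rw [Ne, ← ZMod.valMinAbs_eq_zero] at h
    exact Finset.mem_Icc.2 ⟨Nat.one_le_iff_ne_zero.2 (by simpa using h), ZMod.natAbs_valMinAbs_le _⟩
  have hinj : Set.InjOn (fun j : ℕ ↦ (d * j : ZMod M).valMinAbs.natAbs)
      (Finset.Icc 1 (M / 2)) := fun i hi j hj hij ↦ by
    have hi := Finset.mem_Icc.1 hi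
    have hj := Finset.mem_Icc.1 hj
    have hdvd : ∀ k : ℤ, (d * k : ZMod M) = 0 → (M : ℤ) ∣ k := fun k hk ↦ by
      have h2 : ((d * k : ℤ) : ZMod M) = 0 := by exact_mod_cast hk
      rw [ZMod.intCast_zmod_eq_zero_iff_dvd] at h2
      exact hd.dvd_of_dvd_mul_left h2
    rcases ZMod.natAbs_valMinAbs_eq_natAbs_valMinAbs.1 hij with h | h
    · have := hdvd (i - j) (by push_cast; rw [mul_sub, h, sub_self])
      have := Int.eq_zero_of_abs_lt_dvd this (by rw [abs_lt]; omega)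
      omega
    · have := hdvd (i + j) (by push_cast; rw [mul_add, h, neg_add_cancel])
      have := Int.eq_zero_of_abs_lt_dvd this (by obtain ⟨k, hk⟩ := hM; rw [abs_lt]; omega)
      omega
  exact ⟨hmaps, hinj, Finset.surjOn_of_injOn_of_card_le _ hmaps hinj le_rfl⟩

theorem etaMultiplier_pow_24 (B : SL(2, ℤ)) : etaMultiplier B ^ 24 = 1 := by
  have h1 := eta_smul_pow B UpperHalfPlane.I
  have hd := SL2Z_denom_ne_zero B UpperHalfPlane.I
  have hη : η ((UpperHalfPlane.I : ℍ) : ℂ) ≠ 0 := ModularForm.eta_ne_zero UpperHalfPlane.I.2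
  rw [eta_smul_eq_etaMultiplier, mul_pow, mul_pow, ← cpow_nat_mul] at h1
  have h2 : ((24 : ℕ) : ℂ) * (1 / 2) = (12 : ℕ) := by norm_num
  rw [h2, cpow_natCast, mul_assoc] at h1
  exact mul_right_cancel₀ (mul_ne_zero (pow_ne_zero 12 hd) (pow_ne_zero 24 hη))
    (h1.trans (one_mul _).symm)

theorem etaMultiplier_ne_zero (B : SL(2, ℤ)) : etaMultiplier B ≠ 0 := fun h ↦ by
  simpa [h] using etaMultiplier_pow_24 B

theorem kleinForm_sign_mul (v : ℤ) (hv : v ≠ 0) (M : ℂ) {τ : ℂ} (hτ : 0 < τ.im) :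
    kleinForm 0 (v / M) τ = v.sign * kleinForm 0 (v.natAbs / M) τ := by
  rcases lt_or_gt_of_ne hv with h | h
  · have e : (v : ℂ) = -(v.natAbs : ℂ) := by
      have : v = -(v.natAbs : ℤ) := by omega
      exact_mod_cast this
    rw [e, Int.sign_eq_neg_one_of_neg h, neg_div, ← neg_zero, kleinForm_neg _ _ hτ, neg_zero]
    simp
  · have e : (v : ℂ) = (v.natAbs : ℂ) := by
      conv_lhs => rw [show v = (v.natAbs : ℤ) by omega]
      rw [Int.cast_natCast]
    rw [e, Int.sign_eq_one_of_pos h]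
    simp

/-- As M divides γ, the image of (0, j/M) is an integral translate of (0, v/M), and oddness replaces
v by |v|. With v a least residue of δj, the matrix permutes the points j/M up to sign. -/
theorem kleinForm_torsion_smul {M : ℕ} (hM : 0 < M) (B : SL(2, ℤ)) {g : ℤ} (hg : B 1 0 = M * g)
    (j : ℕ) {v n : ℤ} (hv : v ≠ 0) (hn : B 1 1 * j = v + M * n) (τ : ℍ) :
    kleinForm 0 (j / M) ((B • τ : ℍ) : ℂ) = ((B 1 0 : ℂ) * τ + (B 1 1 : ℂ))⁻¹ *
      (exp (π * I * ((j * g + n : ℤ) - B 1 1 * j ^ 2 * g / M)) * v.sign) *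
        kleinForm 0 (v.natAbs / M) τ := by
  have hM0 : (M : ℂ) ≠ 0 := Nat.cast_ne_zero.2 hM.ne'
  have hn' : (B 1 1 : ℂ) * j = v + M * n := by exact_mod_cast hn
  have h1 : (0 : ℂ) * B 0 0 + j / M * B 1 0 = 0 + (j * g : ℤ) := by
    rw [hg]
    push_cast
    field_simp
    ring
  have h2 : (0 : ℂ) * B 0 1 + j / M * B 1 1 = v / M + n := by
    field_simp
    linear_combination hn'
  -- After substituting v = δj - Mn, the two exponents differ by πi times the even integer 2jgn.
  have h3 : (-1 : ℂ) ^ ((j * g : ℤ) + n + j * g * n) *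
      exp (π * I * (0 * n - v / M * (j * g : ℤ))) =
        exp (π * I * ((j * g + n : ℤ) - B 1 1 * j ^ 2 * g / M)) := by
    have h4 : (v : ℂ) = B 1 1 * j - M * n := by linear_combination -hn'
    rw [h4, ← exp_pi_mul_I_mul_int, ← exp_add, exp_eq_exp_iff_exists_int]
    refine ⟨j * g * n, ?_⟩
    push_cast
    field_simp
    ring
  rw [kleinForm_smul, h1, h2, kleinForm_add_int _ _ τ.im_pos, h3, kleinForm_sign_mul v hv _ τ.im_pos]
  ring

/-- This is why the cube of the multiplier is taken: a factor 3 makes the sum of squares divisible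
by M = 2h + 1, clearing the denominator of the accumulated phase. -/
theorem sum_Icc_natCast_sq (h : ℕ) :
    3 * ∑ j ∈ Finset.Icc 1 h, (j : ℤ) ^ 2 = (2 * h + 1) * ∑ j ∈ Finset.Icc 1 h, (j : ℤ) := by
  induction h with
  | zero => simp
  | succ k ih =>
    have e : ∀ i : ℕ, 2 * ∑ j ∈ Finset.Icc 1 i, (j : ℤ) = i * (i + 1) := fun i ↦ by
      induction i with
      | zero => simp
      | succ l il =>
        rw [Finset.sum_Icc_succ_top (by omega), mul_add, il]
        push_cast
        ring
    rw [Finset.sum_Icc_succ_top (by omega), Finset.sum_Icc_succ_top (by omega), mul_add, ih]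
    push_cast
    linear_combination - e k

/-- Passing from `B` to `B_M`, `M` odd, the cube of the multiplier of `η` changes by a sign which
only depends on the lower right entry of `B`. -/
theorem etaMultiplier_scaledMatrix_pow_three {M : ℕ} (hM : Odd M) (B : SL(2, ℤ))
    (hB : (M : ℤ) ∣ B 1 0) (hd : Odd (B 1 1)) :
    etaMultiplier (scaledMatrix M B hB) ^ 3 =
      gaussSign M (B 1 1) * etaMultiplier B ^ (3 * M) := by
  have hcop : IsCoprime (M : ℤ) (B 1 1) := by
    have hdet := B.det_coe
    rw [Matrix.det_fin_two] at hdet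
    obtain ⟨k, hk⟩ := hB
    exact ⟨-(B 0 1 * k), B 0 0, by rw [hk] at hdet; linarith⟩
  obtain ⟨g, hg⟩ := hB
  obtain ⟨h, hh⟩ := hM
  have hMpos : 0 < M := by omega
  have hM2 : M / 2 = h := by omega
  have hM0 : (M : ℂ) ≠ 0 := Nat.cast_ne_zero.2 hMpos.ne'
  have hbij := bijOn_natAbs_valMinAbs ⟨h, hh⟩ hcop
  rw [hM2] at hbij
  let v : ℕ → ℤ := fun j ↦ (B 1 1 * j : ZMod M).valMinAbs
  have hv : ∀ j ∈ Finset.Icc 1 h, v j ≠ 0 := fun j hj ↦ by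
    have hj := Finset.mem_Icc.1 hj
    have := isCoprime_mul_natCast_ne_zero hcop (j := j) (by omega) (by omega)
    rwa [Ne, ← ZMod.valMinAbs_eq_zero] at this
  have hex : ∀ j : ℕ, ∃ n : ℤ, B 1 1 * j = v j + M * n := fun j ↦ by
    have : ((B 1 1 * j - v j : ℤ) : ZMod M) = 0 := by simp [v]
    obtain ⟨n, hn⟩ := (ZMod.intCast_zmod_eq_zero_iff_dvd _ _).1 this
    exact ⟨n, by linarith⟩
  choose n hn using hex
  obtain ⟨C, hC, hprod⟩ := exists_mul_eta_eq_prod_kleinForm h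
  rw [← hh] at hprod
  let τ : ℍ := UpperHalfPlane.I
  let ε : ℕ → ℂ := fun j ↦ exp (π * I * ((j * g + n j : ℤ) - B 1 1 * j ^ 2 * g / M))
  have hK : ∏ j ∈ Finset.Icc 1 h, kleinForm 0 (j / M) ((B • τ : ℍ) : ℂ) =
      ((B 1 0 : ℂ) * τ + (B 1 1 : ℂ))⁻¹ ^ h *
        ((∏ j ∈ Finset.Icc 1 h, ε j) * gaussSign M (B 1 1)) *
          ∏ j ∈ Finset.Icc 1 h, kleinForm 0 (j / M) τ := by
    have e1 : ∏ j ∈ Finset.Icc 1 h, kleinForm 0 ((v j).natAbs / M) τ =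
        ∏ j ∈ Finset.Icc 1 h, kleinForm 0 (j / M) τ :=
      Finset.prod_nbij (fun j ↦ (v j).natAbs) hbij.mapsTo hbij.injOn hbij.surjOn fun _ _ ↦ rfl
    rw [Finset.prod_congr rfl fun j hj ↦ kleinForm_torsion_smul hMpos B hg j (hv j hj) (hn j) τ,
      Finset.prod_mul_distrib, Finset.prod_mul_distrib, Finset.prod_mul_distrib, e1,
      Finset.prod_const, Nat.card_Icc, Nat.add_sub_cancel, gaussSign, hM2, Int.cast_prod]
  have hν : etaMultiplier (scaledMatrix M B ⟨g, hg⟩) =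
      etaMultiplier B ^ M * ((∏ j ∈ Finset.Icc 1 h, ε j) * gaussSign M (B 1 1)) := by
    have e1 := hprod _ (B • τ).im_pos
    have e2 := hprod _ τ.im_pos
    have hη : η (M * (τ : ℂ)) ≠ 0 := ModularForm.eta_ne_zero (natCast_mul_im_pos hMpos τ)
    have hx := SL2Z_denom_ne_zero B τ
    have hsq := cpow_half_mul_self ((B 1 0 : ℂ) * τ + (B 1 1 : ℂ))
    rw [hK, eta_natCast_mul_smul hMpos B ⟨g, hg⟩, eta_smul_eq_etaMultiplier] at e1
    generalize ((B 1 0 : ℂ) * τ + (B 1 1 : ℂ)) ^ (1 / 2 : ℂ) = s at *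
    rw [← hsq] at hx e1
    have hs := left_ne_zero_of_mul hx
    -- M factors η of weight 1/2 and h Klein forms of weight -1 leave weight M/2 - h = 1/2.
    have hpow : s ^ M * (s * s)⁻¹ ^ h = s := by
      rw [hh, pow_succ, pow_mul, inv_pow, ← sq, mul_right_comm,
        mul_inv_cancel₀ (pow_ne_zero _ (pow_ne_zero _ hs)), one_mul]
    refine mul_right_cancel₀ (mul_ne_zero hs (mul_ne_zero hC hη)) ?_
    rw [mul_pow, mul_pow] at e1
    linear_combination e1 + etaMultiplier B ^ M * η (τ : ℂ) ^ M *
      ((∏ j ∈ Finset.Icc 1 h, ε j) * gaussSign M (B 1 1)) *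
        (∏ j ∈ Finset.Icc 1 h, kleinForm 0 (j / M) τ) * hpow - etaMultiplier B ^ M * s *
      ((∏ j ∈ Finset.Icc 1 h, ε j) * gaussSign M (B 1 1)) * e2
  have hε : (∏ j ∈ Finset.Icc 1 h, ε j) ^ 3 = 1 := by
    have e1 : ∑ j ∈ Finset.Icc 1 h, ((v j).natAbs : ℤ) = ∑ j ∈ Finset.Icc 1 h, (j : ℤ) :=
      Finset.sum_nbij (fun j ↦ (v j).natAbs) hbij.mapsTo hbij.injOn hbij.surjOn fun _ _ ↦ rfl
    -- Since δ and M are odd, δj = v + Mn gives n ≡ j - |v| (mod 2), and the |v_j| permute the j.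
    have e2 : Even (∑ j ∈ Finset.Icc 1 h, n j) := by
      have e3 : ∀ j : ℕ, Even (n j - (j - (v j).natAbs)) := fun j ↦ by
        obtain ⟨d', hd'⟩ := hd
        have := hn j
        rw [hh, hd'] at this
        push_cast at this
        rcases Int.natAbs_eq (v j) with hvj | hvj
        · refine ⟨d' * j - h * n j, ?_⟩
          linarith
        · refine ⟨d' * j - h * n j + (v j).natAbs, ?_⟩
          linarith
      have e4 := Finset.even_sum (s := Finset.Icc 1 h) _ fun j _ ↦ e3 j
      rwa [Finset.sum_sub_distrib, Finset.sum_sub_distrib, e1, sub_self, sub_zero] at e4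
    have e5 := sum_Icc_natCast_sq h
    obtain ⟨N', hN'⟩ := e2
    obtain ⟨d', hd'⟩ := hd
    set S := ∑ j ∈ Finset.Icc 1 h, (j : ℤ) with hS
    set Q := ∑ j ∈ Finset.Icc 1 h, (j : ℤ) ^ 2 with hQ
    have e6 : ∑ j ∈ Finset.Icc 1 h, (π * I * ((j * g + n j : ℤ) - B 1 1 * j ^ 2 * g / M)) =
        π * I * ((S * g + (N' + N') : ℤ) - (B 1 1 * Q * g : ℤ) / M) := by
      rw [← Finset.mul_sum, Finset.sum_sub_distrib, ← hN', hS, hQ]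
      push_cast
      rw [Finset.sum_add_distrib, Finset.sum_mul, Finset.mul_sum, Finset.sum_mul, Finset.sum_div]
    have e7 : (3 * Q : ℂ) = M * S := by
      rw [hh]
      exact_mod_cast e5
    simp only [ε]
    rw [← exp_sum, e6, ← exp_nat_mul, exp_eq_one_iff]
    -- By 3Q = MS, three times the exponent is πi(gS(3 - δ) + 6N'), an even multiple of πi because δ
    -- = 2d' + 1.
    refine ⟨g * S * (1 - d') + 3 * N', ?_⟩
    rw [hd']
    push_cast
    field_simp
    linear_combination - g * (2 * d' + 1) * e7
  rw [hν, mul_pow, mul_pow, hε, one_mul, ← pow_mul, mul_comm M 3, mul_comm]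
  congr 1
  have := gaussSign_sq hcop
  rw [pow_succ, ← Int.cast_pow, this, Int.cast_one, one_mul]

theorem scaledMatrix_scaledMatrix (l m : ℕ) (B : SL(2, ℤ)) (h : ((m * l : ℕ) : ℤ) ∣ B 1 0)
    (h1 : (m : ℤ) ∣ B 1 0) (h2 : (l : ℤ) ∣ scaledMatrix m B h1 1 0) :
    scaledMatrix l (scaledMatrix m B h1) h2 = scaledMatrix (m * l) B h := by
  ext i j
  fin_cases i <;> fin_cases j
  · simp [scaledMatrix]
  · simp [scaledMatrix]; ring
  · simp [scaledMatrix, Int.ediv_ediv_of_nonneg]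
  · simp [scaledMatrix]

theorem natCast_dvd_scaledMatrix {l m : ℕ} (hm : 0 < m) {B : SL(2, ℤ)}
    (h : ((m * l : ℕ) : ℤ) ∣ B 1 0) (h1 : (m : ℤ) ∣ B 1 0) :
    (l : ℤ) ∣ scaledMatrix m B h1 1 0 := by
  obtain ⟨k, hk⟩ := h
  refine ⟨k, ?_⟩
  have : B 1 0 = m * (l * k) := by rw [hk]; push_cast; ring
  simp [scaledMatrix, this, Int.mul_ediv_cancel_left _ (show (m : ℤ) ≠ 0 by omega)]

/-- Passing from B to B_c twice gives the Gauss sign to the even power c + 1 and ν(B)^(3c²), where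
3c² ≡ 3 (mod 24) as c is odd. -/
theorem etaMultiplier_scaledMatrix_sq_pow_three {c : ℕ} (hc : Odd c) (B : SL(2, ℤ))
    (hB : ((c * c : ℕ) : ℤ) ∣ B 1 0) (hd : Odd (B 1 1)) :
    etaMultiplier (scaledMatrix (c * c) B hB) ^ 3 = etaMultiplier B ^ 3 := by
  have h1 : (c : ℤ) ∣ B 1 0 := (Int.natCast_dvd_natCast.2 (dvd_mul_right c c)).trans hB
  have h2 := natCast_dvd_scaledMatrix hc.pos hB h1
  have hcop : IsCoprime (c : ℤ) (B 1 1) := by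
    have hdet := B.det_coe
    rw [Matrix.det_fin_two] at hdet
    obtain ⟨k, hk⟩ := h1
    exact ⟨-(B 0 1 * k), B 0 0, by rw [hk] at hdet; linarith⟩
  have h3 : scaledMatrix c B h1 1 1 = B 1 1 := rfl
  rw [← scaledMatrix_scaledMatrix c c B hB h1 h2,
    etaMultiplier_scaledMatrix_pow_three hc _ h2 hd, pow_mul,
    etaMultiplier_scaledMatrix_pow_three hc _ h1 hd, h3, mul_pow, ← mul_assoc, ← pow_succ']
  obtain ⟨k, hk⟩ := hc
  have h4 : (gaussSign c (B 1 1) : ℂ) ^ (c + 1) = 1 := by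
    have : c + 1 = 2 * (k + 1) := by omega
    rw [this, pow_mul, ← Int.cast_pow, gaussSign_sq hcop, Int.cast_one, one_pow]
  obtain ⟨l, hl⟩ : Even (k * (k + 1)) := Nat.even_mul_succ_self k
  have h5 : 3 * c * c = 24 * l + 3 := by
    rw [hk]
    linarith
  rw [h4, one_mul, ← pow_mul, h5, pow_add, pow_mul, etaMultiplier_pow_24, one_pow, one_mul]

/-! ### The additional factors of g and h as generalized eta functions. -/

theorem qPochhammerInf_eq_mul_sq (a : ℂ) {q : ℂ} (hq : ‖q‖ < 1) :
    qPochhammerInf a q = qPochhammerInf a (q ^ 2) * qPochhammerInf (a * q) (q ^ 2) := by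
  have hq2 : ‖q ^ 2‖ < 1 := by
    rw [norm_pow]
    exact pow_lt_one₀ (norm_nonneg _) hq two_ne_zero
  have h0 (k : ℕ) : 1 - a * q ^ (2 * k) = 1 - a * (q ^ 2) ^ k := by rw [pow_mul]
  have h1 (k : ℕ) : 1 - a * q ^ (2 * k + 1) = 1 - a * q * (q ^ 2) ^ k := by
    rw [pow_succ', pow_mul, mul_assoc]
  have := tprod_even_mul_odd (f := fun n : ℕ ↦ 1 - a * q ^ n)
    (by simpa only [h0] using multipliable_one_sub_mul_pow a hq2)
    (by simpa only [h1] using multipliable_one_sub_mul_pow (a * q) hq2)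
  simp only [h0, h1] at this
  exact this.symm

/-- Splitting products by parity, (q, q³; q⁴) = (q; q²) = (q; q)/(q²; q²); the leading exponents
agree as 1/8 = (4 + 1 - 2)/24. -/
theorem generalizedEta_four_one {τ : ℂ} (hτ : 0 < τ.im) :
    generalizedEta 4 1 τ = η (4 * τ) * η τ / η (2 * τ) := by
  have hq := norm_exp_two_pi_I_mul_lt_one hτ
  have h2τ : 0 < (2 * τ).im := by simpa using hτ
  have hη := ModularForm.eta_ne_zero h2τ
  have hq2' := norm_exp_two_pi_I_mul_lt_one h2τ
  rw [eq_div_iff hη]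
  simp only [eta_eq_exp_mul_qPochhammerInf, generalizedEta]
  set q := exp (2 * π * I * τ) with hq_def
  have e2 : exp (2 * π * I * (2 * τ)) = q ^ 2 := by rw [hq_def, ← exp_nat_mul]; push_cast; ring_nf
  have e4 : exp (2 * π * I * (4 * τ)) = q ^ 4 := by rw [hq_def, ← exp_nat_mul]; push_cast; ring_nf
  have e1 : exp (2 * π * I * τ * (1 : ℤ)) = q := by simp [hq_def]
  have e3 : exp (2 * π * I * τ * ((4 : ℕ) - (1 : ℤ))) = q ^ 3 := by
    rw [hq_def, ← exp_nat_mul]; push_cast; ring_nf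
  have e4' : exp (2 * π * I * τ * (4 : ℕ)) = q ^ 4 := by rw [hq_def, ← exp_nat_mul]; ring_nf
  have e5 : exp (2 * π * I * τ * ((((4 : ℕ) : ℂ) - 2 * (1 : ℤ)) ^ 2 / (8 * (4 : ℕ)))) *
      exp (2 * π * I * (2 * τ) / 24) = exp (2 * π * I * (4 * τ) / 24) * exp (2 * π * I * τ / 24) := by
    rw [← exp_add, ← exp_add]
    push_cast
    ring_nf
  rw [e2] at hq2'
  rw [e1, e2, e3, e4, e4', qPochhammerInf_eq_mul_sq q hq, qPochhammerInf_eq_mul_sq q hq2', ← sq,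
    ← pow_succ', ← pow_mul]
  linear_combination qPochhammerInf q (q ^ 4) * qPochhammerInf (q ^ 3) (q ^ 4) *
    qPochhammerInf (q ^ 4) (q ^ 4) * qPochhammerInf (q ^ 2) (q ^ 2) * e5

theorem generalizedEta_natCast_mul {N : ℕ} (hN : 0 < N) (ρ : ℤ) {l : ℕ} (hl : 0 < l) (τ : ℂ) :
    generalizedEta (N * l) (ρ * l) τ = generalizedEta N ρ (l * τ) := by
  have hN0 : (N : ℂ) ≠ 0 := Nat.cast_ne_zero.2 hN.ne'
  have hl0 : (l : ℂ) ≠ 0 := Nat.cast_ne_zero.2 hl.ne'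
  simp only [generalizedEta]
  push_cast
  have e1 : 2 * π * I * τ * (((N : ℂ) * l - 2 * (ρ * l)) ^ 2 / (8 * (N * l))) =
      2 * π * I * (l * τ) * ((N - 2 * ρ) ^ 2 / (8 * N)) := by
    field_simp
  have e2 : 2 * π * I * τ * (ρ * l) = 2 * π * I * (l * τ) * ρ := by ring
  have e3 : 2 * π * I * τ * (N * l) = 2 * π * I * (l * τ) * N := by ring
  have e4 : 2 * π * I * τ * ((N : ℂ) * l - ρ * l) = 2 * π * I * (l * τ) * (N - ρ) := by ring
  rw [e1, e2, e3, e4]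

/-! ### The transformation law of the quotient f. -/

theorem prod_zpow_eq_zpow_sum {ι : Type*} (s : Finset ι) {a : ℂ} (ha : a ≠ 0) (r : ι → ℤ) :
    ∏ i ∈ s, a ^ r i = a ^ ∑ i ∈ s, r i := by
  classical
  induction s using Finset.induction_on with
  | empty => simp
  | insert i s hi ih => rw [Finset.prod_insert hi, Finset.sum_insert hi, ih, zpow_add₀ ha]

theorem neg_one_zpow_eq_of_even_sub {a b : ℤ} (h : Even (a - b)) : (-1 : ℂ) ^ a = (-1) ^ b := by
  rw [← sub_add_cancel a b, zpow_add₀ (by simp), h.neg_one_zpow, one_mul]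

/-- The data of a matrix in `Γ₀(4c²) ∩ Γ₁(4c)` which enter the transformation laws. -/
theorem exists_of_mem_Gamma0_inf_Gamma1 {c : ℕ} {B : SL(2, ℤ)}
    (hB : B ∈ Gamma0 (4 * c ^ 2) ⊓ Gamma1 (4 * c)) :
    ∃ m : ℤ, B 0 0 - 1 = 4 * c * m ∧ ((4 * c ^ 2 : ℕ) : ℤ) ∣ B 1 0 ∧ Odd (B 1 1) := by
  obtain ⟨h0, h1⟩ := hB
  replace h1 := (Gamma1_mem _ _).1 h1
  have e1 : ((B 0 0 - 1 : ℤ) : ZMod (4 * c)) = 0 := by push_cast; rw [h1.1, sub_self]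
  have e2 : ((B 1 1 - 1 : ℤ) : ZMod (4 * c)) = 0 := by push_cast; rw [h1.2.1, sub_self]
  rw [ZMod.intCast_zmod_eq_zero_iff_dvd] at e1 e2
  obtain ⟨m, hm⟩ := e1
  obtain ⟨n, hn⟩ := e2
  refine ⟨m, by rw [hm]; push_cast; ring, dvd_of_mem_Gamma0 dvd_rfl h0, 2 * c * n, ?_⟩
  push_cast at hn
  linarith

/-- The phase is written with one part linear in k and one quadratic, so that the product over k
depends only on ∑ r_k k and ∑ r_k k². -/
theorem generalizedEta_smul_of_mem {c : ℕ} (hc : Odd c) (k : ℕ) {B : SL(2, ℤ)}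
    (h : ((4 * c ^ 2 : ℕ) : ℤ) ∣ B 1 0) {m : ℤ} (hm : B 0 0 - 1 = 4 * c * m) (τ : ℍ) :
    generalizedEta (4 * c ^ 2) ((c * k : ℕ) : ℤ) ((B • τ : ℍ) : ℂ) =
      exp (π * I * (k * (m + B 0 1 + m * B 0 1 : ℤ) + k ^ 2 * B 0 1 / 4)) *
        (etaMultiplier (scaledMatrix (4 * c ^ 2) B h) ^ 3 *
          ((B 1 0 : ℂ) * τ + (B 1 1 : ℂ)) ^ (1 / 2 : ℂ)) *
            generalizedEta (4 * c ^ 2) ((c * k : ℕ) : ℤ) τ := by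
  have hc0 : (c : ℂ) ≠ 0 := Nat.cast_ne_zero.2 hc.pos.ne'
  have hN : 0 < 4 * c ^ 2 := by have := hc.pos; positivity
  rw [generalizedEta_smul hN _ (k * m) B h (by rw [hm]; push_cast; ring), mul_add, exp_add]
  have e1 : (-1 : ℂ) ^ ((k * m : ℤ) + ((c * k : ℕ) : ℤ) * B 0 1 +
      k * m * (((c * k : ℕ) : ℤ) * B 0 1)) = exp (π * I * (k * (m + B 0 1 + m * B 0 1 : ℤ))) := by
    have : (k : ℂ) * (m + B 0 1 + m * B 0 1 : ℤ) = (k * (m + B 0 1 + m * B 0 1) : ℤ) := by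
      push_cast
      ring
    rw [this, exp_pi_mul_I_mul_int]
    apply neg_one_zpow_eq_of_even_sub
    -- Modulo 2, the odd c may be replaced by 1 and k² by k.
    obtain ⟨d, rfl⟩ := hc
    obtain ⟨l, hl⟩ := Int.even_mul_succ_self ((k : ℤ) - 1)
    rw [sub_add_cancel] at hl
    refine ⟨d * k * B 0 1 + m * B 0 1 * (d * k * k + l), ?_⟩
    push_cast
    linear_combination m * B 0 1 * hl
  have e2 : (((c * k : ℕ) : ℤ) : ℂ) ^ 2 * B 0 1 / (4 * c ^ 2 : ℕ) = k ^ 2 * B 0 1 / 4 := by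
    push_cast
    field_simp
  rw [e1, e2]
  ring

theorem sum_mul_natCast_modEq (s : Finset ℕ) (r : ℕ → ℤ) :
    ∑ i ∈ s, r i * i ≡ ∑ i ∈ s with i % 2 = 1, r i [ZMOD 2] := by
  rw [Finset.sum_filter]
  refine Int.ModEq.sum fun i _ ↦ ?_
  obtain ⟨j, hj | hj⟩ : ∃ j, i = 2 * j ∨ i = 2 * j + 1 := ⟨i / 2, by omega⟩
  · rw [if_neg (by omega), hj]
    exact Int.modEq_iff_dvd.2 ⟨-(r (2 * j) * j), by push_cast; ring⟩
  · rw [if_pos (by omega), hj]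
    exact Int.modEq_iff_dvd.2 ⟨-(r (2 * j + 1) * j), by push_cast; ring⟩

/-- Squares modulo 8 are 1 for odd k, 4 for k ≡ 2 (mod 4) and 0 for 4 ∣ k. This is where S and T
enter. -/
theorem sum_mul_natCast_sq_modEq (s : Finset ℕ) (r : ℕ → ℤ) :
    ∑ i ∈ s, r i * i ^ 2 ≡
      ∑ i ∈ s with i % 2 = 1, r i + 4 * ∑ i ∈ s with i % 4 = 2, r i [ZMOD 8] := by
  rw [Finset.sum_filter, Finset.sum_filter, Finset.mul_sum, ← Finset.sum_add_distrib]
  refine Int.ModEq.sum fun i _ ↦ ?_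
  obtain ⟨j, hj | hj | hj⟩ : ∃ j, i = 4 * j ∨ i = 4 * j + 2 ∨ i = 2 * j + 1 := by
    rcases Nat.even_or_odd' i with ⟨a, ha | ha⟩
    · exact ⟨i / 4, by omega⟩
    · exact ⟨a, by omega⟩
  · rw [if_neg (by omega), if_neg (by omega), hj]
    exact Int.modEq_iff_dvd.2 ⟨-(r (4 * j) * 2 * j ^ 2), by push_cast; ring⟩
  · rw [if_neg (by omega), if_pos (by omega), hj]
    exact Int.modEq_iff_dvd.2 ⟨-(r (4 * j + 2) * (2 * j ^ 2 + 2 * j)), by push_cast; ring⟩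
  · rw [if_pos (by omega), if_neg (by omega), hj]
    obtain ⟨l, hl⟩ := Nat.even_mul_succ_self j
    have hl : (j : ℤ) * (j + 1) = l + l := by exact_mod_cast hl
    exact Int.modEq_iff_dvd.2 ⟨-(r (2 * j + 1) * l), by
      push_cast
      linear_combination -(4 * r (2 * j + 1)) * hl⟩

/-- B_{4c²} is (B_4)_{c²}, and the passage to the index c² does not change ν³. -/
theorem etaMultiplier_scaledMatrix_four_mul_sq {c : ℕ} (hc : Odd c) {B : SL(2, ℤ)}
    (h : ((4 * c ^ 2 : ℕ) : ℤ) ∣ B 1 0) (h4 : ((4 : ℕ) : ℤ) ∣ B 1 0) (hd : Odd (B 1 1)) :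
    etaMultiplier (scaledMatrix (4 * c ^ 2) B h) ^ 3 = etaMultiplier (scaledMatrix 4 B h4) ^ 3 := by
  have hsq : c ^ 2 = c * c := sq c
  have h' : ((4 * (c * c) : ℕ) : ℤ) ∣ B 1 0 := by rwa [← hsq]
  have e : scaledMatrix (4 * c ^ 2) B h = scaledMatrix (4 * (c * c)) B h' := by congr 2
  have h2 := natCast_dvd_scaledMatrix (by norm_num) h' h4
  rw [e, ← scaledMatrix_scaledMatrix _ _ B h' h4 h2]
  exact etaMultiplier_scaledMatrix_sq_pow_three hc _ h2 hd

/-- The phase by which the product of the `f_{4c², ck} ^ r_k` is multiplied. -/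
theorem prod_exp_zpow_eq (n : ℕ) (r : ℕ → ℤ) (u β : ℤ)
    (hS : ∑ i ∈ Finset.Icc 1 n with i % 2 = 1, r i ≡ -1 [ZMOD 8])
    (hT : ∑ i ∈ Finset.Icc 1 n with i % 4 = 2, r i ≡ 0 [ZMOD 2]) :
    ∏ k ∈ Finset.Icc 1 n, exp (π * I * (k * (u : ℤ) + k ^ 2 * β / 4)) ^ r k =
      (-1) ^ u * exp (-(π * I * β / 4)) := by
  have hX := sum_mul_natCast_modEq (Finset.Icc 1 n) r
  have hY := sum_mul_natCast_sq_modEq (Finset.Icc 1 n) r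
  set X := ∑ i ∈ Finset.Icc 1 n, r i * (i : ℤ) with hX_def
  set Y := ∑ i ∈ Finset.Icc 1 n, r i * (i : ℤ) ^ 2 with hY_def
  obtain ⟨x, hx⟩ : ∃ x, X = 1 + 2 * x := ⟨X / 2, by
    have := hX; have := hS; simp only [Int.ModEq] at *; omega⟩
  obtain ⟨y, hy⟩ : ∃ y, Y = -1 + 8 * y := ⟨(Y + 1) / 8, by
    have := hY; have := hS; have := hT; simp only [Int.ModEq] at *; omega⟩
  simp_rw [← exp_int_mul]
  rw [← exp_sum, ← exp_pi_mul_I_mul_int, ← exp_add, exp_eq_exp_iff_exists_int]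
  -- With X = 1 + 2x and Y = -1 + 8y, uX + βY/4 exceeds u - β/4 by 2(ux + βy).
  refine ⟨u * x + β * y, ?_⟩
  have e : ∑ k ∈ Finset.Icc 1 n, (r k : ℂ) * (π * I * (k * (u : ℤ) + k ^ 2 * β / 4)) =
      π * I * (u * X + β * Y / 4) := by
    rw [hX_def, hY_def]
    push_cast
    rw [Finset.mul_sum, Finset.mul_sum, Finset.sum_div, ← Finset.sum_add_distrib, Finset.mul_sum]
    exact Finset.sum_congr rfl fun k _ ↦ by ring
  rw [e, hx, hy]
  push_cast
  ring

theorem generalizedEtaQuotient_smul {c : ℕ} (hc : Odd c) {r₀ : ℤ} {r : ℕ → ℤ}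
    (hweight : r₀ + ∑ i ∈ Finset.Icc 1 (2 * c), r i = 1)
    (hR : ∑ i ∈ Finset.Icc 1 (2 * c), r i ≡ -2 [ZMOD 12])
    (hS : ∑ i ∈ Finset.Icc 1 (2 * c) with i % 2 = 1, r i ≡ -1 [ZMOD 8])
    (hT : ∑ i ∈ Finset.Icc 1 (2 * c) with i % 4 = 2, r i ≡ 0 [ZMOD 2]) {B : SL(2, ℤ)}
    (h : ((4 * c ^ 2 : ℕ) : ℤ) ∣ B 1 0) (h4 : ((4 : ℕ) : ℤ) ∣ B 1 0) (hd : Odd (B 1 1)) {m : ℤ}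
    (hm : B 0 0 - 1 = 4 * c * m) (τ : ℍ) :
    generalizedEtaQuotient c r₀ r (B • τ) =
      (-1) ^ (m + B 0 1 + m * B 0 1) * exp (-(π * I * B 0 1 / 4)) *
        etaMultiplier (scaledMatrix 4 B h4) ^ (-3 : ℤ) *
          ((B 1 0 : ℂ) * τ + (B 1 1 : ℂ)) ^ (1 / 2 : ℂ) * generalizedEtaQuotient c r₀ r τ := by
  have hN : 0 < 4 * c ^ 2 := by have := hc.pos; positivity
  have hν := etaMultiplier_scaledMatrix_four_mul_sq hc h h4 hd
  have hν0 := etaMultiplier_ne_zero (scaledMatrix (4 * c ^ 2) B h)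
  have hν24 := etaMultiplier_pow_24 (scaledMatrix (4 * c ^ 2) B h)
  have hη := eta_natCast_mul_smul hN B h τ
  have hs : ((B 1 0 : ℂ) * τ + (B 1 1 : ℂ)) ^ (1 / 2 : ℂ) ≠ 0 := by
    simp [cpow_eq_zero_iff, SL2Z_denom_ne_zero B τ]
  push_cast at hη
  simp only [generalizedEtaQuotient]
  rw [hη, Finset.prod_congr rfl fun k _ ↦ by
    rw [generalizedEta_smul_of_mem hc k h hm τ, mul_zpow, mul_zpow], Finset.prod_mul_distrib,
    Finset.prod_mul_distrib, prod_exp_zpow_eq _ r _ _ hS hT,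
    prod_zpow_eq_zpow_sum _ (mul_ne_zero (pow_ne_zero 3 hν0) hs), mul_zpow, mul_zpow, mul_zpow]
  have e1 : etaMultiplier (scaledMatrix 4 B h4) ^ (-3 : ℤ) =
      etaMultiplier (scaledMatrix (4 * c ^ 2) B h) ^ (-3 : ℤ) := by
    rw [zpow_neg, zpow_neg, zpow_ofNat, zpow_ofNat, hν]
  rw [e1]
  generalize etaMultiplier (scaledMatrix (4 * c ^ 2) B h) = ν at *
  generalize ((B 1 0 : ℂ) * τ + (B 1 1 : ℂ)) ^ (1 / 2 : ℂ) = s at *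
  set R := ∑ i ∈ Finset.Icc 1 (2 * c), r i with hR_def
  obtain ⟨t, ht⟩ : ∃ t, R = -2 + 12 * t := ⟨(R + 2) / 12, by simp only [Int.ModEq] at hR; omega⟩
  -- With R = -2 + 12t and r₀ = 1 - R, the exponent r₀ + 3R is 24t - 3.
  have e2 : ν ^ r₀ * (ν ^ 3) ^ R = ν ^ (-3 : ℤ) := by
    rw [← zpow_natCast ν 3, ← zpow_mul, ← zpow_add₀ hν0]
    have : r₀ + ((3 : ℕ) : ℤ) * R = ((24 : ℕ) : ℤ) * t + -3 := by push_cast; linarith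
    rw [this, zpow_add₀ hν0, zpow_mul, zpow_natCast, hν24, one_zpow, one_mul]
  have e3 : s ^ r₀ * s ^ R = s := by rw [← zpow_add₀ hs, hweight, zpow_one]
  rw [← e2]
  conv_rhs => rw [← e3]
  ring

/-! ### Expansions with non-vanishing holomorphic part. -/

/-- `F(τ) = q_N ^ n φ(q_N)` with `q_N = exp (2πiτ/N)` and `φ` holomorphic without zeros on the open
unit disc. -/
def HasNonvanishingExpansion (F : ℍ → ℂ) : Prop :=
  ∃ (N : ℕ) (n : ℤ) (φ : ℂ → ℂ), 0 < N ∧ DifferentiableOn ℂ φ (Metric.ball 0 1) ∧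
    (∀ x ∈ Metric.ball (0 : ℂ) 1, φ x ≠ 0) ∧
      ∀ τ : ℍ, F τ = exp (2 * π * I * n * τ / N) * φ (exp (2 * π * I * τ / N))

theorem norm_exp_div_natCast_lt_one {N : ℕ} (hN : 0 < N) (τ : ℍ) :
    ‖exp (2 * π * I * τ / N)‖ < 1 := by
  rw [mul_div_assoc]
  refine norm_exp_two_pi_I_mul_lt_one ?_
  rw [div_natCast_im]
  have := τ.im_pos
  positivity

theorem exp_div_natCast_mem_ball {N : ℕ} (hN : 0 < N) (τ : ℍ) :
    exp (2 * π * I * τ / N) ∈ Metric.ball (0 : ℂ) 1 := by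
  simpa using norm_exp_div_natCast_lt_one hN τ

namespace HasNonvanishingExpansion

variable {F G : ℍ → ℂ}

theorem const {C : ℂ} (hC : C ≠ 0) : HasNonvanishingExpansion fun _ ↦ C :=
  ⟨1, 0, fun _ ↦ C, one_pos, differentiableOn_const C, fun _ _ ↦ hC, fun τ ↦ by simp⟩

theorem congr (hF : HasNonvanishingExpansion F) (h : ∀ τ, G τ = F τ) :
    HasNonvanishingExpansion G := by
  rwa [funext h]

theorem pow_mem_ball {x : ℂ} (hx : x ∈ Metric.ball (0 : ℂ) 1) {k : ℕ} (hk : 0 < k) {u : ℂ}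
    (hu : ‖u‖ ≤ 1) : u * x ^ k ∈ Metric.ball (0 : ℂ) 1 := by
  rw [mem_ball_zero_iff] at *
  rw [norm_mul, norm_pow]
  exact mul_lt_one_of_nonneg_of_lt_one_right hu (by positivity)
    (pow_lt_one₀ (norm_nonneg _) hx hk.ne')

theorem mul (hF : HasNonvanishingExpansion F) (hG : HasNonvanishingExpansion G) :
    HasNonvanishingExpansion fun τ ↦ F τ * G τ := by
  obtain ⟨N, n, φ, hN, hd, h0, h⟩ := hF
  obtain ⟨N', n', φ', hN', hd', h0', h'⟩ := hG
  have hN0 : (N : ℂ) ≠ 0 := Nat.cast_ne_zero.2 hN.ne'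
  have hN0' : (N' : ℂ) ≠ 0 := Nat.cast_ne_zero.2 hN'.ne'
  have hmem : ∀ k : ℕ, 0 < k → ∀ x ∈ Metric.ball (0 : ℂ) 1, x ^ k ∈ Metric.ball (0 : ℂ) 1 :=
    fun k hk x hx ↦ by simpa only [one_mul] using pow_mem_ball hx hk (u := 1) (by simp)
  refine ⟨N * N', n * N' + n' * N, fun x ↦ φ (x ^ N') * φ' (x ^ N), by positivity, ?_,
    fun x hx ↦ mul_ne_zero (h0 _ (hmem _ hN' x hx)) (h0' _ (hmem _ hN x hx)), fun τ ↦ ?_⟩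
  · exact (hd.comp (by fun_prop) (hmem _ hN')).mul (hd'.comp (by fun_prop) (hmem _ hN))
  · have e1 : exp (2 * π * I * τ / (N * N' : ℕ)) ^ N' = exp (2 * π * I * τ / N) := by
      rw [← exp_nat_mul]
      push_cast
      field_simp
    have e2 : exp (2 * π * I * τ / (N * N' : ℕ)) ^ N = exp (2 * π * I * τ / N') := by
      rw [← exp_nat_mul]
      push_cast
      field_simp
    have e3 : exp (2 * π * I * (n * N' + n' * N : ℤ) * τ / (N * N' : ℕ)) =
        exp (2 * π * I * n * τ / N) * exp (2 * π * I * n' * τ / N') := by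
      rw [← exp_add]
      push_cast
      congr 1
      field_simp
    beta_reduce
    rw [h, h', e1, e2, e3]
    ring

theorem zpow (hF : HasNonvanishingExpansion F) (k : ℤ) :
    HasNonvanishingExpansion fun τ ↦ F τ ^ k := by
  obtain ⟨N, n, φ, hN, hd, h0, h⟩ := hF
  refine ⟨N, k * n, fun x ↦ φ x ^ k, hN, fun x hx ↦ (hd x hx).zpow (.inl (h0 x hx)),
    fun x hx ↦ zpow_ne_zero k (h0 x hx), fun τ ↦ ?_⟩
  beta_reduce
  rw [h, mul_zpow, ← exp_int_mul]
  push_cast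
  ring_nf

theorem pow (hF : HasNonvanishingExpansion F) (k : ℕ) :
    HasNonvanishingExpansion fun τ ↦ F τ ^ k := by
  simpa using hF.zpow k

theorem finset_prod {ι : Type*} (s : Finset ι) {F : ι → ℍ → ℂ}
    (hF : ∀ i ∈ s, HasNonvanishingExpansion (F i)) :
    HasNonvanishingExpansion fun τ ↦ ∏ i ∈ s, F i τ := by
  classical
  induction s using Finset.induction_on with
  | empty => simpa using const one_ne_zero
  | insert i s hi ih =>
    simp_rw [Finset.prod_insert hi]
    exact (hF i (by simp)).mul (ih fun j hj ↦ hF j (by simp [hj]))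

theorem mdifferentiable (hF : HasNonvanishingExpansion F) : MDifferentiable 𝓘(ℂ) 𝓘(ℂ) F := by
  obtain ⟨N, n, φ, hN, hd, h0, h⟩ := hF
  rw [UpperHalfPlane.mdifferentiable_iff]
  have : DifferentiableOn ℂ (fun z : ℂ ↦ exp (2 * π * I * n * z / N) * φ (exp (2 * π * I * z / N)))
      {z | 0 < z.im} :=
    .mul (by fun_prop) (hd.comp (by fun_prop) fun z hz ↦ exp_div_natCast_mem_ball hN ⟨z, hz⟩)
  refine this.congr fun z hz ↦ ?_
  rw [Function.comp_apply, h, ofComplex_apply_of_im_pos hz]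

theorem exists_hasSum (hF : HasNonvanishingExpansion F) :
    ∃ (N : ℕ) (n₀ : ℤ) (a : ℕ → ℂ), 0 < N ∧ ∀ τ : ℍ,
      HasSum (fun m : ℕ ↦ a m * exp (2 * π * I * ((n₀ : ℂ) + m) * τ / N)) (F τ) := by
  obtain ⟨N, n, φ, hN, hd, h0, h⟩ := hF
  refine ⟨N, n, fun m ↦ (m.factorial : ℂ)⁻¹ * iteratedDeriv m φ 0, hN, fun τ ↦ ?_⟩
  have := (hasSum_taylorSeries_on_ball hd (exp_div_natCast_mem_ball hN τ)).mul_left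
    (exp (2 * π * I * n * τ / N))
  rw [h]
  refine this.congr_fun fun m ↦ ?_
  have e : exp (2 * π * I * (n + m) * τ / N) =
      exp (2 * π * I * n * τ / N) * exp (2 * π * I * τ / N) ^ m := by
    rw [← exp_nat_mul, ← exp_add]
    ring_nf
  rw [e, smul_eq_mul, smul_eq_mul, sub_zero]
  ring

end HasNonvanishingExpansion

theorem affine_im_pos {a d : ℕ} (ha : 0 < a) (hd : 0 < d) (b : ℤ) (τ : ℍ) :
    0 < (((a : ℂ) * τ + b) / d).im := by
  rw [div_natCast_im]
  have := τ.im_pos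
  simp only [add_im, mul_im, natCast_re, natCast_im, zero_mul, add_zero, intCast_im]
  positivity

/-- The point `(aτ + b) / d` of the upper half plane. -/
noncomputable def affinePoint {a d : ℕ} (ha : 0 < a) (hd : 0 < d) (b : ℤ) (τ : ℍ) : ℍ :=
  ⟨((a : ℂ) * τ + b) / d, affine_im_pos ha hd b τ⟩

theorem norm_exp_two_pi_I_mul_ofReal (t : ℝ) : ‖exp (2 * π * I * t)‖ = 1 := by
  have : 2 * π * I * t = (2 * π * t : ℝ) * I := by push_cast; ring
  rw [this, norm_exp_ofReal_mul_I]

/-- At (aτ + b)/d the parameter q_N becomes a root of unity times the a-th power of q_{dN}, and this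
map preserves the unit disc. -/
theorem HasNonvanishingExpansion.comp_affinePoint {F : ℍ → ℂ} (hF : HasNonvanishingExpansion F)
    {a d : ℕ} (ha : 0 < a) (hd : 0 < d) (b : ℤ) :
    HasNonvanishingExpansion fun τ ↦ F (affinePoint ha hd b τ) := by
  obtain ⟨N, n, φ, hN, hφ, h0, h⟩ := hF
  have hN0 : (N : ℂ) ≠ 0 := Nat.cast_ne_zero.2 hN.ne'
  have hd0 : (d : ℂ) ≠ 0 := Nat.cast_ne_zero.2 hd.ne'
  have hu : ‖exp (2 * π * I * (b / (d * N)))‖ ≤ 1 := by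
    have := norm_exp_two_pi_I_mul_ofReal (b / (d * N))
    push_cast at this
    exact this.le
  refine ⟨d * N, n * a, fun x ↦ exp (2 * π * I * n * (b / (d * N))) *
    φ (exp (2 * π * I * (b / (d * N))) * x ^ a), by positivity, ?_, fun x hx ↦
      mul_ne_zero (exp_ne_zero _) (h0 _ (pow_mem_ball hx ha hu)), fun τ ↦ ?_⟩
  · exact (hφ.comp (by fun_prop) fun x hx ↦ pow_mem_ball hx ha hu).const_mul _
  · have e1 : exp (2 * π * I * (affinePoint ha hd b τ : ℂ) / N) =
        exp (2 * π * I * (b / (d * N))) * exp (2 * π * I * τ / (d * N : ℕ)) ^ a := by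
      rw [← exp_nat_mul, ← exp_add, affinePoint]
      push_cast
      congr 1
      field_simp
      ring
    have e2 : exp (2 * π * I * n * (affinePoint ha hd b τ : ℂ) / N) =
        exp (2 * π * I * (n * a : ℤ) * τ / (d * N : ℕ)) * exp (2 * π * I * n * (b / (d * N))) := by
      rw [← exp_add, affinePoint]
      push_cast
      congr 1
      field_simp
    beta_reduce
    rw [h, e1, e2, mul_assoc]

theorem qPochhammerInf_mul_pow_ne_zero {u x : ℂ} (hu : ‖u‖ ≤ 1) (hx : ‖x‖ < 1) {k m : ℕ}
    (hm : 0 < m) (h : 0 < k ∨ u ≠ 1) : qPochhammerInf (u * x ^ k) (x ^ m) ≠ 0 := by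
  have hx' : x ∈ Metric.ball (0 : ℂ) 1 := by simpa using hx
  refine qPochhammerInf_ne_zero ?_ fun n hn ↦ ?_
  · rw [norm_pow]
    exact pow_lt_one₀ (norm_nonneg _) hx hm.ne'
  · rw [← pow_mul, mul_assoc, ← pow_add] at hn
    rcases Nat.eq_zero_or_pos (k + m * n) with h1 | h1
    · rw [h1, pow_zero, mul_one] at hn
      rcases h with h | h
      · omega
      · exact h hn
    · have := HasNonvanishingExpansion.pow_mem_ball hx' h1 hu
      simp [hn] at this

theorem differentiableOn_qPochhammerInf_mul_pow (u : ℂ) (k : ℕ) {m : ℕ} (hm : 0 < m) :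
    DifferentiableOn ℂ (fun x ↦ qPochhammerInf (u * x ^ k) (x ^ m)) (Metric.ball 0 1) :=
  differentiableOn_qPochhammerInf Metric.isOpen_ball (by fun_prop) (by fun_prop) fun x hx ↦ by
    rw [norm_pow]
    exact pow_lt_one₀ (norm_nonneg _) (by simpa using hx) hm.ne'

theorem hasNonvanishingExpansion_eta : HasNonvanishingExpansion fun τ ↦ η (τ : ℂ) := by
  refine ⟨24, 1, fun x ↦ qPochhammerInf (1 * x ^ 24) (x ^ 24), by norm_num,
    differentiableOn_qPochhammerInf_mul_pow 1 24 (by norm_num), fun x hx ↦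
      qPochhammerInf_mul_pow_ne_zero (by simp) (by simpa using hx) (by norm_num)
        (.inl (by norm_num)), fun τ ↦ ?_⟩
  have e : exp (2 * π * I * τ / (24 : ℕ)) ^ 24 = exp (2 * π * I * τ) := by
    rw [← exp_nat_mul]
    push_cast
    ring_nf
  simp only [one_mul, e, eta_eq_exp_mul_qPochhammerInf, Int.cast_one, mul_one]
  push_cast
  rfl

/-- For 0 ≤ p < N both products have nonnegative powers of q, the second a positive one. The
remaining hypothesis excludes characteristics at which the Klein form vanishes identically. -/
theorem hasNonvanishingExpansion_kleinForm_of_lt {N p : ℕ} (hp : p < N) (y : ℝ)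
    (h : 0 < p ∨ ∀ n : ℤ, y ≠ n) : HasNonvanishingExpansion fun τ ↦ kleinForm (p / N) y τ := by
  have hN : 0 < N := by omega
  have hN0 : (N : ℂ) ≠ 0 := Nat.cast_ne_zero.2 hN.ne'
  have hu := norm_exp_two_pi_I_mul_ofReal y
  have hu' : ‖(exp (2 * π * I * y))⁻¹‖ = 1 := by rw [norm_inv, hu, inv_one]
  have hL : 0 < 2 * N ^ 2 := by positivity
  have hlt : 2 * N * p < 2 * N ^ 2 := by
    rw [sq, ← mul_assoc]
    exact Nat.mul_lt_mul_of_pos_left hp (by positivity)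
  -- The leading exponent a(a - 1)/2 with a = p/N has denominator dividing 2N².
  refine ⟨2 * N ^ 2, p ^ 2 - p * N, fun x ↦ exp (π * I * (y * (p / N - 1))) *
    (qPochhammerInf (exp (2 * π * I * y) * x ^ (2 * N * p)) (x ^ (2 * N ^ 2)) *
      qPochhammerInf ((exp (2 * π * I * y))⁻¹ * x ^ (2 * N ^ 2 - 2 * N * p)) (x ^ (2 * N ^ 2))) *
        (qPochhammerInf (1 * x ^ (2 * N ^ 2)) (x ^ (2 * N ^ 2)) ^ 2)⁻¹, hL, ?_, ?_, fun τ ↦ ?_⟩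
  · refine .mul (.const_mul (.mul ?_ ?_) _) (.inv (.pow ?_ 2) fun x hx ↦ pow_ne_zero 2 ?_)
    · exact differentiableOn_qPochhammerInf_mul_pow _ _ hL
    · exact differentiableOn_qPochhammerInf_mul_pow _ _ hL
    · exact differentiableOn_qPochhammerInf_mul_pow _ _ hL
    · exact qPochhammerInf_mul_pow_ne_zero (by simp) (by simpa using hx) hL (.inl hL)
  · intro x hx
    have hx' : ‖x‖ < 1 := by simpa using hx
    refine mul_ne_zero (mul_ne_zero (exp_ne_zero _) (mul_ne_zero ?_ ?_))
      (inv_ne_zero (pow_ne_zero 2 ?_))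
    · refine qPochhammerInf_mul_pow_ne_zero hu.le hx' hL ?_
      rcases h with h | h
      · exact .inl (by positivity)
      · refine .inr fun h1 ↦ ?_
        obtain ⟨n, hn⟩ := (exp_two_pi_I_mul_eq_one_iff _).1 h1
        exact h n (by exact_mod_cast hn)
    · exact qPochhammerInf_mul_pow_ne_zero hu'.le hx' hL (.inl (by omega))
    · exact qPochhammerInf_mul_pow_ne_zero (by simp) hx' hL (.inl hL)
  · set x := exp (2 * π * I * τ / (2 * N ^ 2 : ℕ)) with hx_def
    have e0 : x ^ (2 * N ^ 2) = exp (2 * π * I * τ) := by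
      rw [hx_def, ← exp_nat_mul]
      push_cast
      congr 1
      field_simp
    have e1 : exp (2 * π * I * y) * x ^ (2 * N * p) = exp (2 * π * I * (p / N * τ + y)) := by
      rw [hx_def, ← exp_nat_mul, ← exp_add]
      push_cast
      congr 1
      field_simp
      ring
    have e2 : (exp (2 * π * I * y))⁻¹ * x ^ (2 * N ^ 2 - 2 * N * p) =
        exp (2 * π * I * (τ - (p / N * τ + y))) := by
      rw [hx_def, ← exp_nat_mul, ← exp_neg, ← exp_add, Nat.cast_sub hlt.le]
      push_cast
      congr 1
      field_simp
      ring
    have e3 : exp (π * I * (p / N * (p / N * τ + y))) * exp (-(π * I * (p / N * τ + y))) =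
        exp (2 * π * I * (p ^ 2 - p * N : ℤ) * τ / (2 * N ^ 2 : ℕ)) *
          exp (π * I * (y * (p / N - 1))) := by
      rw [← exp_add, ← exp_add]
      push_cast
      congr 1
      field_simp
      ring
    beta_reduce
    rw [kleinForm, kleinProduct, e1, e2, one_mul, e0]
    linear_combination (qPochhammerInf (exp (2 * π * I * (p / N * τ + y))) (exp (2 * π * I * τ)) *
      qPochhammerInf (exp (2 * π * I * (τ - (p / N * τ + y)))) (exp (2 * π * I * τ))) *
        (qPochhammerInf (exp (2 * π * I * τ)) (exp (2 * π * I * τ)) ^ 2)⁻¹ * e3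

theorem hasNonvanishingExpansion_kleinForm {N : ℕ} (hN : 0 < N) {s t : ℤ}
    (hst : ¬ ((N : ℤ) ∣ s ∧ (N : ℤ) ∣ t)) :
    HasNonvanishingExpansion fun τ ↦ kleinForm (s / N) (t / N) τ := by
  have hN0 : (N : ℂ) ≠ 0 := Nat.cast_ne_zero.2 hN.ne'
  have hNR : (N : ℝ) ≠ 0 := Nat.cast_ne_zero.2 hN.ne'
  have hNZ : (N : ℤ) ≠ 0 := by omega
  obtain ⟨p, hp⟩ := Int.eq_ofNat_of_zero_le (Int.emod_nonneg s hNZ)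
  have hs : s = p + N * (s / N) := by rw [← hp, Int.emod_add_mul_ediv]
  have hpN : p < N := by
    have := Int.emod_lt_of_pos s (show (0 : ℤ) < N by omega)
    omega
  have h : 0 < p ∨ ∀ n : ℤ, (t / N : ℝ) ≠ n := by
    by_contra! hcon
    obtain ⟨h1, n, h2⟩ := hcon
    rw [div_eq_iff hNR] at h2
    refine hst ⟨⟨s / N, ?_⟩, ⟨n, ?_⟩⟩
    · have : p = 0 := by omega
      rw [this] at hs
      simpa using hs
    · rw [mul_comm]
      exact_mod_cast h2
  have h1 := hasNonvanishingExpansion_kleinForm_of_lt hpN (t / N) h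
  have h2 : (s / N : ℂ) = p / N + (s / N : ℤ) := by
    have : (s : ℂ) = p + N * (s / N : ℤ) := by exact_mod_cast hs
    field_simp
    exact this
  have hC : (-1 : ℂ) ^ (s / N : ℤ) * exp (-(π * I * (t / N * (s / N : ℤ)))) ≠ 0 :=
    mul_ne_zero (zpow_ne_zero _ (by simp)) (exp_ne_zero _)
  refine ((HasNonvanishingExpansion.const hC).mul h1).congr fun τ ↦ ?_
  rw [h2, kleinForm_add_int_left _ _ τ.im_pos]
  push_cast
  rfl

/-! ### Expansions at all cusps. -/

/-- Every `diag(N, 1) B` with `B ∈ SL(2, ℤ)` is `A (a, b; 0, d)` with `A ∈ SL(2, ℤ)` and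
`a, d > 0`. -/
theorem exists_natCast_mul_smul_eq {N : ℕ} (hN : 0 < N) (B : SL(2, ℤ)) :
    ∃ (A : SL(2, ℤ)) (a d : ℕ) (b : ℤ) (ha : 0 < a) (hd : 0 < d), ∀ τ : ℍ,
      (N : ℂ) * ((B • τ : ℍ) : ℂ) = ((A • affinePoint ha hd b τ : ℍ) : ℂ) ∧
        (A 1 0 : ℂ) * affinePoint ha hd b τ + (A 1 1 : ℂ) =
          ((B 1 0 : ℂ) * τ + (B 1 1 : ℂ)) / d := by
  have hdet := B.det_coe
  rw [Matrix.det_fin_two] at hdet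
  have hg : 0 < Int.gcd (N * B 0 0) (B 1 0) := by
    refine Int.gcd_pos_iff.2 ?_
    by_contra! h
    have h0 : B 0 0 = 0 := by
      rcases mul_eq_zero.1 h.1 with h1 | h1
      · omega
      · exact h1
    rw [h0, h.2] at hdet
    simp at hdet
  -- The first column (Nα, γ) of diag(N, 1)B, divided by its gcd g, is the first column of A; Bézout
  -- completes it, and d = N/g by determinants.
  obtain ⟨p, q, hcop, hp, hq⟩ := Int.exists_gcd_one hg
  set g := Int.gcd (N * B 0 0) (B 1 0) with hg_def
  obtain ⟨u, w, huw⟩ := Int.isCoprime_iff_gcd_eq_one.2 hcop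
  have hgd : (g : ℤ) * (p * B 1 1 - q * N * B 0 1) = N := by
    linear_combination (N : ℤ) * hdet - B 1 1 * hp + N * B 0 1 * hq
  have hdpos : 0 < p * B 1 1 - q * N * B 0 1 := by
    refine pos_of_mul_pos_right (a := (g : ℤ)) ?_ (by omega)
    rw [hgd]
    omega
  obtain ⟨d, hd⟩ := Int.eq_ofNat_of_zero_le hdpos.le
  have hd' : 0 < d := by omega
  have hdC : (d : ℂ) ≠ 0 := Nat.cast_ne_zero.2 hd'.ne'
  let A : SL(2, ℤ) := ⟨!![p, -w; q, u], by rw [Matrix.det_fin_two_of]; linarith⟩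
  have hpC : (N : ℂ) * B 0 0 = p * g := by exact_mod_cast hp
  have hqC : (B 1 0 : ℂ) = q * g := by exact_mod_cast hq
  have hdC' : (p : ℂ) * B 1 1 - q * N * B 0 1 = d := by exact_mod_cast hd
  have huwC : (u : ℂ) * p + w * q = 1 := by exact_mod_cast huw
  refine ⟨A, g, d, u * N * B 0 1 + w * B 1 1, hg, hd', fun τ ↦ ?_⟩
  have e0 : (affinePoint hg hd' (u * N * B 0 1 + w * B 1 1) τ : ℂ) =
      (g * τ + (u * N * B 0 1 + w * B 1 1)) / d := by
    simp [affinePoint]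
  have e1 : (A 1 0 : ℂ) * affinePoint hg hd' (u * N * B 0 1 + w * B 1 1) τ + (A 1 1 : ℂ) =
      ((B 1 0 : ℂ) * τ + (B 1 1 : ℂ)) / d := by
    rw [e0, hqC]
    change (q : ℂ) * _ + u = _
    field_simp
    linear_combination B 1 1 * huwC - u * hdC'
  have e2 : (A 0 0 : ℂ) * affinePoint hg hd' (u * N * B 0 1 + w * B 1 1) τ + (A 0 1 : ℂ) =
      N * ((B 0 0 : ℂ) * τ + (B 0 1 : ℂ)) / d := by
    rw [e0]
    change (p : ℂ) * _ + ((-w : ℤ) : ℂ) = _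
    push_cast
    field_simp
    linear_combination N * B 0 1 * huwC + w * hdC' - τ * hpC
  refine ⟨?_, e1⟩
  rw [coe_SL2Z_smul A, e1, e2, coe_SL2Z_smul, div_div_div_cancel_right₀ hdC, mul_div_assoc]

/-- Division by a positive number leaves the argument unchanged, so the principal power is
multiplicative here. -/
theorem div_natCast_cpow {x : ℂ} (hx : x ≠ 0) {d : ℕ} (hd : 0 < d) (s : ℂ) :
    (x / d) ^ s = x ^ s * ((d : ℂ)⁻¹) ^ s := by
  have hdR : (0 : ℝ) < (d : ℝ)⁻¹ := by positivity
  have hd0 : (d : ℂ)⁻¹ ≠ 0 := inv_ne_zero (Nat.cast_ne_zero.2 hd.ne')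
  have h := log_mul_ofReal _ hdR x hx
  rw [ofReal_log hdR.le] at h
  push_cast at h
  rw [div_eq_mul_inv, cpow_def_of_ne_zero (mul_ne_zero hx hd0), h, cpow_def_of_ne_zero hx,
    cpow_def_of_ne_zero hd0, ← exp_add]
  ring_nf

/-- `F(Bτ) = √(γτ + δ) ^ k E(τ)`, where `E` has a non-vanishing expansion. -/
def HasExpansionAt (B : SL(2, ℤ)) (k : ℤ) (F : ℍ → ℂ) : Prop :=
  ∃ E : ℍ → ℂ, HasNonvanishingExpansion E ∧ ∀ τ : ℍ,
    F (B • τ) = (((B 1 0 : ℂ) * τ + (B 1 1 : ℂ)) ^ (1 / 2 : ℂ)) ^ k * E τ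

theorem cpow_half_ne_zero (B : SL(2, ℤ)) (τ : ℍ) :
    ((B 1 0 : ℂ) * τ + (B 1 1 : ℂ)) ^ (1 / 2 : ℂ) ≠ 0 := by
  simp [cpow_eq_zero_iff, SL2Z_denom_ne_zero B τ]

namespace HasExpansionAt

variable {B : SL(2, ℤ)} {k l : ℤ} {F G : ℍ → ℂ}

theorem mul (hF : HasExpansionAt B k F) (hG : HasExpansionAt B l G) :
    HasExpansionAt B (k + l) fun τ ↦ F τ * G τ := by
  obtain ⟨E, hE, h⟩ := hF
  obtain ⟨E', hE', h'⟩ := hG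
  refine ⟨_, hE.mul hE', fun τ ↦ ?_⟩
  beta_reduce
  rw [h, h', zpow_add₀ (cpow_half_ne_zero B τ)]
  ring

theorem zpow (hF : HasExpansionAt B k F) (n : ℤ) :
    HasExpansionAt B (k * n) fun τ ↦ F τ ^ n := by
  obtain ⟨E, hE, h⟩ := hF
  exact ⟨_, hE.zpow n, fun τ ↦ by beta_reduce; rw [h, mul_zpow, zpow_mul]⟩

theorem finset_prod {ι : Type*} (s : Finset ι) {k : ι → ℤ} {F : ι → ℍ → ℂ}
    (hF : ∀ i ∈ s, HasExpansionAt B (k i) (F i)) :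
    HasExpansionAt B (∑ i ∈ s, k i) fun τ ↦ ∏ i ∈ s, F i τ := by
  classical
  induction s using Finset.induction_on with
  | empty => exact ⟨_, .const one_ne_zero, fun τ ↦ by simp⟩
  | insert i s hi ih =>
    simp_rw [Finset.prod_insert hi, Finset.sum_insert hi]
    exact (hF i (by simp)).mul (ih fun j hj ↦ hF j (by simp [hj]))

theorem hasNonvanishingExpansion (hF : HasExpansionAt B 2 F) : HasNonvanishingExpansion fun τ ↦
    ((B 1 0 : ℂ) * τ + (B 1 1 : ℂ)) ^ (-1 : ℤ) * F (B • τ) := by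
  obtain ⟨E, hE, h⟩ := hF
  refine hE.congr fun τ ↦ ?_
  rw [h, zpow_ofNat, sq, cpow_half_mul_self, zpow_neg_one,
    inv_mul_cancel_left₀ (SL2Z_denom_ne_zero B τ)]

end HasExpansionAt

theorem hasExpansionAt_eta {N : ℕ} (hN : 0 < N) (B : SL(2, ℤ)) :
    HasExpansionAt B 1 fun τ ↦ η (N * (τ : ℂ)) := by
  obtain ⟨A, a, d, b, ha, hd, h⟩ := exists_natCast_mul_smul_eq hN B
  have hC : etaMultiplier A * ((d : ℂ)⁻¹) ^ (1 / 2 : ℂ) ≠ 0 := by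
    simp [cpow_eq_zero_iff, etaMultiplier_ne_zero, hd.ne']
  refine ⟨_, (HasNonvanishingExpansion.const hC).mul
    (hasNonvanishingExpansion_eta.comp_affinePoint ha hd b), fun τ ↦ ?_⟩
  beta_reduce
  rw [(h τ).1, eta_smul_eq_etaMultiplier, (h τ).2,
    div_natCast_cpow (SL2Z_denom_ne_zero B τ) hd, zpow_one]
  ring

theorem hasExpansionAt_generalizedEta {N : ℕ} (hN : 0 < N) {ρ : ℤ} (hρ : ¬ (N : ℤ) ∣ ρ)
    (B : SL(2, ℤ)) : HasExpansionAt B 1 fun τ ↦ generalizedEta N ρ τ := by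
  obtain ⟨A, a, d, b, ha, hd, h⟩ := exists_natCast_mul_smul_eq hN B
  have hd0 : (d : ℂ) ≠ 0 := Nat.cast_ne_zero.2 hd.ne'
  have hC : etaMultiplier A ^ 3 * (((d : ℂ)⁻¹) ^ (1 / 2 : ℂ)) ≠ 0 := by
    simp [cpow_eq_zero_iff, etaMultiplier_ne_zero, hd.ne']
  -- The first row of A is primitive, so A cannot make the non-integral characteristic (ρ/N, 0)
  -- integral.
  have hst : ¬ ((N : ℤ) ∣ ρ * A 0 0 ∧ (N : ℤ) ∣ ρ * A 0 1) := fun ⟨h1, h2⟩ ↦ by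
    have hdet := A.det_coe
    rw [Matrix.det_fin_two] at hdet
    have : ρ = ρ * A 0 0 * A 1 1 - ρ * A 0 1 * A 1 0 := by linear_combination -ρ * hdet
    exact hρ (this ▸ dvd_sub (h1.mul_right _) (h2.mul_right _))
  refine ⟨_, ((HasNonvanishingExpansion.const hC).mul
    ((hasNonvanishingExpansion_kleinForm hN hst).comp_affinePoint ha hd b)).mul
      ((hasNonvanishingExpansion_eta.comp_affinePoint ha hd b).pow 3), fun τ ↦ ?_⟩
  have hx := SL2Z_denom_ne_zero B τ
  have hsq := cpow_half_mul_self ((B 1 0 : ℂ) * τ + (B 1 1 : ℂ))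
  have hsqd := cpow_half_mul_self ((d : ℂ)⁻¹)
  have e1 : (ρ / N : ℂ) * A 0 0 + 0 * A 1 0 = (ρ * A 0 0 : ℤ) / N := by push_cast; ring
  have e2 : (ρ / N : ℂ) * A 0 1 + 0 * A 1 1 = (ρ * A 0 1 : ℤ) / N := by push_cast; ring
  beta_reduce
  rw [generalizedEta_eq_kleinForm hN _ (B • τ).im_pos, (h τ).1, kleinForm_smul,
    eta_smul_eq_etaMultiplier, (h τ).2, div_natCast_cpow hx hd, zpow_one, e1, e2]
  generalize ((B 1 0 : ℂ) * τ + (B 1 1 : ℂ)) ^ (1 / 2 : ℂ) = s at *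
  generalize ((d : ℂ)⁻¹) ^ (1 / 2 : ℂ) = t at *
  rw [div_eq_mul_inv, ← hsq, ← hsqd]
  have hs : s ≠ 0 := left_ne_zero_of_mul (hsq ▸ hx)
  have ht : t ≠ 0 := left_ne_zero_of_mul (hsqd ▸ inv_ne_zero hd0)
  field_simp

theorem not_dvd_natCast_mul {c : ℕ} (hc : Odd c) {k : ℕ} (hk : k ∈ Finset.Icc 1 (2 * c)) :
    ¬ ((4 * c ^ 2 : ℕ) : ℤ) ∣ ((c * k : ℕ) : ℤ) := by
  intro h
  have hk := Finset.mem_Icc.1 hk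
  have hc := hc.pos
  have h1 := Nat.le_of_dvd (Nat.mul_pos hc hk.1) (Int.natCast_dvd_natCast.1 h)
  have h2 : 4 * c ≤ k := Nat.le_of_mul_le_mul_left (by linarith : c * (4 * c) ≤ c * k) hc
  omega

theorem hasExpansionAt_generalizedEtaQuotient {c : ℕ} (hc : Odd c) (r₀ : ℤ) (r : ℕ → ℤ)
    (hweight : r₀ + ∑ i ∈ Finset.Icc 1 (2 * c), r i = 1) (B : SL(2, ℤ)) :
    HasExpansionAt B 1 (generalizedEtaQuotient c r₀ r) := by
  have hN : 0 < 4 * c ^ 2 := by have := hc.pos; positivity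
  have h := ((hasExpansionAt_eta hN B).zpow r₀).mul (HasExpansionAt.finset_prod _ fun k hk ↦
    (hasExpansionAt_generalizedEta hN (not_dvd_natCast_mul hc hk) B).zpow (r k))
  simp only [one_mul, hweight] at h
  push_cast at h
  exact h

/-! ### Weak holomorphy of g and h, and the main theorem. -/

/-- The criterion used for both `g` and `h`: the multiplier of `F` is inverse to that of the
generalized eta quotient. -/
theorem isWeaklyHolomorphicModularForm_mul {c : ℕ} (hc : Odd c) {r₀ : ℤ} {r : ℕ → ℤ}
    (hweight : r₀ + ∑ i ∈ Finset.Icc 1 (2 * c), r i = 1)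
    (hR : ∑ i ∈ Finset.Icc 1 (2 * c), r i ≡ -2 [ZMOD 12])
    (hS : ∑ i ∈ Finset.Icc 1 (2 * c) with i % 2 = 1, r i ≡ -1 [ZMOD 8])
    (hT : ∑ i ∈ Finset.Icc 1 (2 * c) with i % 4 = 2, r i ≡ 0 [ZMOD 2]) {F : ℍ → ℂ}
    (hF : ∀ B, HasExpansionAt B 1 F)
    (hF' : ∀ (B : SL(2, ℤ)) (_ : ((4 * c ^ 2 : ℕ) : ℤ) ∣ B 1 0) (h4 : ((4 : ℕ) : ℤ) ∣ B 1 0)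
      (_ : Odd (B 1 1)) (m : ℤ) (_ : B 0 0 - 1 = 4 * c * m) (τ : ℍ),
      F (B • τ) = (-1) ^ (m + B 0 1 + m * B 0 1) * exp (π * I * B 0 1 / 4) *
        etaMultiplier (scaledMatrix 4 B h4) ^ 3 *
          ((B 1 0 : ℂ) * τ + (B 1 1 : ℂ)) ^ (1 / 2 : ℂ) * F τ) :
    IsWeaklyHolomorphicModularForm (Gamma0 (4 * c ^ 2) ⊓ Gamma1 (4 * c)) 1
      (fun τ ↦ F τ * generalizedEtaQuotient c r₀ r τ) := by
  have hexp : ∀ B, HasNonvanishingExpansion _ := fun B ↦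
    ((hF B).mul (hasExpansionAt_generalizedEtaQuotient hc r₀ r hweight B)).hasNonvanishingExpansion
  refine ⟨?_, fun B hB τ ↦ ?_, fun B ↦ (hexp B).exists_hasSum⟩
  -- The expansion at B = 1 already gives holomorphy of the function itself.
  · have := (hexp 1).mdifferentiable
    simpa using this
  · obtain ⟨m, hm, h, hd⟩ := exists_of_mem_Gamma0_inf_Gamma1 hB
    have h4 : ((4 : ℕ) : ℤ) ∣ B 1 0 :=
      (Int.natCast_dvd_natCast.2 (dvd_mul_right 4 (c ^ 2))).trans h
    rw [hF' B h h4 hd m hm, generalizedEtaQuotient_smul hc hweight hR hS hT h h4 hd hm, zpow_one,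
      ← cpow_half_mul_self ((B 1 0 : ℂ) * τ + (B 1 1 : ℂ)), cpow_half_mul_self]
    have e1 : (-1 : ℂ) ^ (m + B 0 1 + m * B 0 1) * (-1) ^ (m + B 0 1 + m * B 0 1) = 1 := by
      rw [← mul_zpow]
      simp
    have e2 : exp (π * I * B 0 1 / 4) * exp (-(π * I * B 0 1 / 4)) = 1 := by
      rw [← exp_add, add_neg_cancel, exp_zero]
    have e3 : etaMultiplier (scaledMatrix 4 B h4) ^ 3 *
        etaMultiplier (scaledMatrix 4 B h4) ^ (-3 : ℤ) = 1 := by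
      rw [zpow_neg, zpow_ofNat, mul_inv_cancel₀ (pow_ne_zero 3 (etaMultiplier_ne_zero _))]
    have e4 := cpow_half_mul_self ((B 1 0 : ℂ) * τ + (B 1 1 : ℂ))
    generalize (-1 : ℂ) ^ (m + B 0 1 + m * B 0 1) = w at *
    generalize exp (-(π * I * B 0 1 / 4)) = y' at *
    generalize exp (π * I * B 0 1 / 4) = y at *
    generalize etaMultiplier (scaledMatrix 4 B h4) ^ (-3 : ℤ) = ν' at *
    generalize etaMultiplier (scaledMatrix 4 B h4) ^ 3 = ν at *
    generalize ((B 1 0 : ℂ) * τ + (B 1 1 : ℂ)) ^ (1 / 2 : ℂ) = s at *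
    calc _ = (w * w) * (y * y') * (ν * ν') * (s * s) * (F τ * generalizedEtaQuotient c r₀ r τ) := by
          ring
      _ = _ := by rw [e1, e2, e3, e4]; ring

theorem corollary4 (c : ℕ) (hc : Odd c) (r₀ : ℤ) (r : ℕ → ℤ) (R S T : ℤ)
    (hR : R = ∑ i ∈ Finset.Icc 1 (2 * c), r i)
    (hS : S = ∑ i ∈ Finset.Icc 1 (2 * c) with i % 2 = 1, r i)
    (hT : T = ∑ i ∈ Finset.Icc 1 (2 * c) with i % 4 = 2, r i)
    (hweight : r₀ + R = 1) (hR12 : R ≡ -2 [ZMOD 12]) (hS8 : S ≡ -1 [ZMOD 8])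
    (hT2 : T ≡ 0 [ZMOD 2]) :
    (∀ (B : SL(2, ℤ)) (hB : B ∈ Gamma0 (4 * c ^ 2) ⊓ Gamma1 (4 * c)) (τ : ℍ),
      generalizedEtaQuotient c r₀ r (B • τ) =
        (-1 : ℂ) ^ (B 0 1 + (B 0 0 - 1) / 4 + B 0 1 * (B 0 0 - 1) / 4 : ℤ) *
          Complex.exp (-(π * Complex.I * (B 0 1 : ℂ) / 4)) *
          etaMultiplier (scaledMatrix 4 B (dvd_of_mem_Gamma0 (dvd_mul_right 4 (c ^ 2)) hB.1)) ^
            (-3 : ℤ) *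
          ((B 1 0 : ℂ) * τ + (B 1 1 : ℂ)) ^ (1 / 2 : ℂ) *
          generalizedEtaQuotient c r₀ r τ) ∧
    IsWeaklyHolomorphicModularForm (Gamma0 (4 * c ^ 2) ⊓ Gamma1 (4 * c)) 1
      (fun τ : ℍ ↦ η (4 * (τ : ℂ)) * η (τ : ℂ) / η (2 * (τ : ℂ)) *
        generalizedEtaQuotient c r₀ r τ) ∧
    IsWeaklyHolomorphicModularForm (Gamma0 (4 * c ^ 2) ⊓ Gamma1 (4 * c)) 1
      (fun τ : ℍ ↦ η (4 * (c : ℂ) ^ 2 * τ) * η ((c : ℂ) ^ 2 * τ) / η (2 * (c : ℂ) ^ 2 * τ) *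
        generalizedEtaQuotient c r₀ r τ) := by
  subst hR hS hT
  have hN : 0 < 4 * c ^ 2 := by have := hc.pos; positivity
  have hc2 : 0 < c ^ 2 := by have := hc.pos; positivity
  have hc0 : (c : ℂ) ≠ 0 := Nat.cast_ne_zero.2 hc.pos.ne'
  refine ⟨fun B hB τ ↦ ?_, ?_, ?_⟩
  · obtain ⟨m, hm, h, hd⟩ := exists_of_mem_Gamma0_inf_Gamma1 hB
    rw [generalizedEtaQuotient_smul hc hweight hR12 hS8 hT2 h
      (dvd_of_mem_Gamma0 (dvd_mul_right 4 (c ^ 2)) hB.1) hd hm]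
    congr 4
    -- Both divisions by 4 are exact because α - 1 = 4cm; as c is odd, cm and m have the same
    -- parity.
    have e1 : (B 0 0 - 1) / 4 = c * m := by
      rw [hm, mul_assoc, Int.mul_ediv_cancel_left _ (by norm_num)]
    have e2 : B 0 1 * (B 0 0 - 1) / 4 = B 0 1 * (c * m) := by
      rw [hm, mul_assoc 4, mul_left_comm, Int.mul_ediv_cancel_left _ (by norm_num)]
    rw [e1, e2]
    apply neg_one_zpow_eq_of_even_sub
    obtain ⟨d, rfl⟩ := hc
    exact ⟨-(d * m + B 0 1 * d * m), by push_cast; ring⟩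
  · have hg : ∀ τ : ℍ, η (4 * (τ : ℂ)) * η (τ : ℂ) / η (2 * (τ : ℂ)) = generalizedEta 4 1 τ :=
      fun τ ↦ (generalizedEta_four_one τ.im_pos).symm
    simp_rw [hg]
    refine isWeaklyHolomorphicModularForm_mul hc hweight hR12 hS8 hT2
      (hasExpansionAt_generalizedEta (by norm_num) (by norm_num)) fun B h h4 hd m hm τ ↦ ?_
    rw [generalizedEta_smul (by norm_num) 1 (c * m) B h4 (by rw [hm]; push_cast; ring)]
    congr 4
    · apply neg_one_zpow_eq_of_even_sub
      obtain ⟨d, rfl⟩ := hc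
      exact ⟨d * m + B 0 1 * d * m, by push_cast; ring⟩
    · push_cast
      ring_nf
  · have hh : ∀ τ : ℍ, η (4 * (c : ℂ) ^ 2 * τ) * η ((c : ℂ) ^ 2 * τ) / η (2 * (c : ℂ) ^ 2 * τ) =
        generalizedEta (4 * c ^ 2) ((c * c : ℕ) : ℤ) τ := fun τ ↦ by
      have e1 := generalizedEta_natCast_mul (N := 4) (by norm_num) 1 hc2 τ
      have e2 := generalizedEta_four_one (natCast_mul_im_pos hc2 τ)
      rw [one_mul, sq c] at e1
      rw [sq c, e1, ← sq c, e2]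
      push_cast
      simp only [mul_assoc]
    simp_rw [hh]
    have hmem : c ∈ Finset.Icc 1 (2 * c) := by
      have := hc.pos
      exact Finset.mem_Icc.2 ⟨by omega, by omega⟩
    refine isWeaklyHolomorphicModularForm_mul hc hweight hR12 hS8 hT2
      (hasExpansionAt_generalizedEta hN (not_dvd_natCast_mul hc hmem)) fun B h h4 hd m hm τ ↦ ?_
    rw [generalizedEta_smul hN _ (c * m) B h (by rw [hm]; push_cast; ring),
      etaMultiplier_scaledMatrix_four_mul_sq hc h h4 hd]
    have e : (((c * c : ℕ) : ℤ) : ℂ) ^ 2 * B 0 1 / (4 * c ^ 2 : ℕ) = c ^ 2 * B 0 1 / 4 := by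
      push_cast
      field_simp
    rw [e]
    obtain ⟨d, rfl⟩ := hc
    obtain ⟨l, hl⟩ := Int.even_mul_succ_self (d : ℤ)
    congr 4
    · apply neg_one_zpow_eq_of_even_sub
      refine ⟨d * m + 4 * l * B 0 1 + m * B 0 1 * (8 * l * d + 4 * l + d), ?_⟩
      push_cast
      linear_combination (4 * B 0 1 + m * (2 * d + 1) * B 0 1 * 4) * hl
    · have hl' : (d : ℂ) * (d + 1) = l + l := by exact_mod_cast hl
      rw [exp_eq_exp_iff_exists_int]
      -- With c = 2d + 1, the phases c²β/4 and β/4 differ by βd(d + 1) = 2lβ, an even integer.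
      refine ⟨l * B 0 1, ?_⟩
      push_cast
      linear_combination π * I * B 0 1 * hl'
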